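/- Let $m$ be a natural number, let $\mathbb B^m$ be the open unit ball of $\mathbb C^m$, and for a complex Hilbert space $\mathcal E$ let $H^2_m\otimes\mathcal E$ be the Hilbert space of holomorphic functions $f:\mathbb B^m\to\mathcal E$, $f(z)=\sum_{k\in\mathbb N^m}a_kz^k$, with $\|f\|^2=\sum_k\|a_k\|^2/\gamma_k<\infty$, where $\gamma_k=\frac{(k_1+\cdots+k_m)!}{k_1!\cdots k_m!}$ (the $\mathcal E$-valued Drury--Arveson space, with reproducing kernel $(1-\sum_i z_i\bar w_i)^{-1}I_{\mathcal E}$). It is a module over $\mathbb C[z_1,\dots,z_m]$ by multiplication of functions. Module maps are bounded linear maps that commute with the action of $\mathbb C[z_1,\dots,z_m]$, submodules in a direct sum $\dotplus$ are closed, and two modules are similar if there is an invertible module map (with bounded inverse) between them. A multiplier $\varphi\in\mathcal M(\mathcal E,\mathcal E_*)$ is a holomorphic function $\varphi:\mathbb B^m\to\mathcal L(\mathcal E,\mathcal E_*)$ such that $\varphi f\in H^2_m\otimes\mathcal E_*$ for all $f\in H^2_m\otimes\mathcal E$; it defines the (bounded) module map $M_\varphi:H^2_m\otimes\mathcal E\to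 H^2_m\otimes\mathcal E_*$, $M_\varphi f=\varphi f$. Let $\mathcal E$, $\mathcal E_*$ be Hilbert spaces and let $\theta\in\mathcal M(\mathcal E,\mathcal E_*)$ be such that $\operatorname{ran}M_\theta$ is closed. Let $\mathcal H_\theta=(H^2_m\otimes\mathcal E_*)/\operatorname{ran}M_\theta$ be the quotient module, with quotient map $\pi_\theta$. Suppose that $\mathcal H_\theta$ is similar to $H^2_m\otimes\mathcal F$ for some Hilbert space $\mathcal F$. Then: 1. there is a multiplier $\varphi\in\mathcal M(\mathcal F,\mathcal E_*)$ such that $H^2_m\otimes\mathcal E_*=\operatorname{ran}M_\varphi\dotplus\operatorname{ran}M_\theta$, an algebraic direct sum of closed submodules; 2. $\operatorname{ran}M_\theta$ is complemented in $H^2_m\otimes\mathcal E_*$, that is, $H^2_m\otimes\mathcal E_*=\operatorname{ran}M_\theta\dotplus\mathcal S$ for some closed submodule $\mathcal S$; 3. the sequence $H^2_m\otimes\mathcal E\xrightarrow{M_\theta}H^2_m\otimes\mathcal E_*\xrightarrow{\pi_\theta}\mathcal H_\theta\to0$ splits, that is, there is a module map $\sigma:\mathcal H_\theta\to H^2_m\otimes\mathcal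 E_*$ with $\pi_\theta\sigma=I_{\mathcal H_\theta}$. -/

import Mathlib

noncomputable section

namespace DruryArveson

/-- The open unit ball `𝔹ᵐ` of `ℂᵐ`. -/
abbrev Ball (m : ℕ) : Type := Metric.ball (0 : EuclideanSpace ℂ (Fin m)) 1

/-- The multinomial coefficient `γ_k = |k|! / (k₁! ⋯ kₘ!)`. -/
def gam {m : ℕ} (k : Fin m → ℕ) : ℕ := Nat.multinomial Finset.univ k

/-- The monomial `z ^ k = z₁ ^ k₁ ⋯ zₘ ^ kₘ`. -/
def mono {m : ℕ} (z : EuclideanSpace ℂ (Fin m)) (k : Fin m → ℕ) : ℂ := ∏ i, z i ^ k i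

/-- The weighted monomial `√γ_k z ^ k`. -/
def wmono {m : ℕ} (z : EuclideanSpace ℂ (Fin m)) (k : Fin m → ℕ) : ℂ :=
  (Real.sqrt (gam k) : ℂ) * mono z k

theorem summable_gam_real {m : ℕ} (u : Fin m → ℝ) (hu : ∀ i, 0 ≤ u i) (h : ∑ i, u i < 1) :
    Summable fun k : Fin m → ℕ => (gam k : ℝ) * ∏ i, u i ^ k i := by
  have h0 : 0 ≤ ∑ i, u i := Finset.sum_nonneg fun i _ => hu i
  refine summable_of_sum_le (c := (1 - ∑ i, u i)⁻¹) (fun k => ?_) fun s => ?_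
  · exact mul_nonneg (Nat.cast_nonneg _) (Finset.prod_nonneg fun i _ => pow_nonneg (hu i) _)
  · classical
    let N := s.sup fun k => ∑ i, k i
    have hs : s ⊆ (Finset.range (N + 1)).biUnion fun n => Finset.piAntidiag Finset.univ n := by
      intro k hk
      simp only [Finset.mem_biUnion, Finset.mem_range, Finset.mem_piAntidiag]
      exact ⟨∑ i, k i, Nat.lt_succ_of_le (Finset.le_sup (f := fun k : Fin m → ℕ => ∑ i, k i) hk),
        rfl, fun i _ => Finset.mem_univ i⟩
    refine (Finset.sum_le_sum_of_subset_of_nonneg hs fun k _ _ =>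
      mul_nonneg (Nat.cast_nonneg _) (Finset.prod_nonneg fun i _ => pow_nonneg (hu i) _)).trans ?_
    rw [Finset.sum_biUnion]
    · have e : ∀ n : ℕ, ∑ k ∈ Finset.piAntidiag Finset.univ n, (gam k : ℝ) * ∏ i, u i ^ k i
          = (∑ i, u i) ^ n := fun n => (Finset.sum_pow_eq_sum_piAntidiag Finset.univ u n).symm
      rw [Finset.sum_congr rfl fun n _ => e n]
      exact ((summable_geometric_of_lt_one h0 h).sum_le_tsum _ fun n _ => pow_nonneg h0 n).trans
        (tsum_geometric_of_lt_one h0 h).le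
    · intro a _ b _ hab
      refine Finset.disjoint_left.2 fun k hka hkb => hab ?_
      rw [Finset.mem_piAntidiag] at hka hkb
      exact hka.1.symm.trans hkb.1

/-- A convergent family indexed by multi-indices may be summed degree by degree. -/
theorem hasSum_degree {m : ℕ} {V : Type*} [NormedAddCommGroup V] [CompleteSpace V]
    {g : (Fin m → ℕ) → V} {a : V} (hg : HasSum g a) :
    HasSum (fun n : ℕ => ∑ k ∈ Finset.piAntidiag Finset.univ n, g k) a := by
  have h := hg.tsum_fiberwise fun k : Fin m → ℕ => ∑ i, k i
  have e : ∀ n : ℕ, ((fun k : Fin m → ℕ => ∑ i, k i) ⁻¹' {n}) =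
      ((Finset.piAntidiag Finset.univ n : Finset (Fin m → ℕ)) : Set (Fin m → ℕ)) := by
    intro n
    ext k
    simp
  refine h.congr_fun fun n => ?_
  rw [tsum_congr_set_coe g (e n)]
  exact (Finset.tsum_subtype _ g).symm

theorem sum_norm_sq_lt {m : ℕ} (z : Ball m) : ∑ i, ‖z.1 i‖ ^ 2 < 1 := by
  have h : ‖z.1‖ < 1 := mem_ball_zero_iff.1 z.2
  rw [← EuclideanSpace.norm_sq_eq]
  nlinarith [norm_nonneg z.1]

theorem summable_wmono_sq {m : ℕ} (z : Ball m) : Summable fun k => ‖wmono z.1 k‖ ^ 2 := by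
  refine (summable_gam_real (fun i => ‖z.1 i‖ ^ 2) (fun i => by positivity)
    (sum_norm_sq_lt z)).congr fun k => ?_
  simp only [wmono, mono, norm_mul, mul_pow, norm_prod, norm_pow, Complex.norm_real,
    Real.norm_eq_abs, sq_abs, Real.sq_sqrt (Nat.cast_nonneg _), ← Finset.prod_pow]
  congr 1
  exact Finset.prod_congr rfl fun i _ => by rw [← pow_mul, ← pow_mul, mul_comm]

/-- The Hilbert space `H²ₘ ⊗ 𝓔 = H²ₘ(𝓔)` of the `𝓔`-valued functions
`f z = ∑ a_k z ^ k` on the ball with `‖f‖² = ∑ ‖a_k‖² / γ_k < ∞`. It is modelled on the family of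
normalised coefficients `c_k = a_k / √γ_k`, a square summable family with `‖f‖² = ∑ ‖c_k‖²`;
the function attached to an element is `f z = ∑ √γ_k z ^ k c_k`, see the instance `rkhs`. -/
def DASpace (m : ℕ) (E : Type*) [NormedAddCommGroup E] [InnerProductSpace ℂ E] : Type _ :=
  lp (fun _ : Fin m → ℕ => E) 2

namespace DASpace

section

variable {m : ℕ} {E : Type*} [NormedAddCommGroup E] [InnerProductSpace ℂ E]

instance : NormedAddCommGroup (DASpace m E) :=
  inferInstanceAs (NormedAddCommGroup (lp (fun _ : Fin m → ℕ => E) 2))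

instance : InnerProductSpace ℂ (DASpace m E) :=
  inferInstanceAs (InnerProductSpace ℂ (lp (fun _ : Fin m → ℕ => E) 2))

instance [CompleteSpace E] : CompleteSpace (DASpace m E) :=
  inferInstanceAs (CompleteSpace (lp (fun _ : Fin m → ℕ => E) 2))

/-- The normalised coefficient `c_k = a_k / √γ_k` of `f z = ∑ a_k z ^ k`. -/
def coeff (f : DASpace m E) (k : Fin m → ℕ) : E :=
  (show lp (fun _ : Fin m → ℕ => E) 2 from f) k

theorem coeff_add (f g : DASpace m E) (k : Fin m → ℕ) : (f + g).coeff k = f.coeff k + g.coeff k :=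
  rfl

theorem coeff_smul (a : ℂ) (f : DASpace m E) (k : Fin m → ℕ) : (a • f).coeff k = a • f.coeff k :=
  rfl

theorem summable_coeff_sq (f : DASpace m E) : Summable fun k => ‖f.coeff k‖ ^ 2 := by
  have h := (lp.memℓp (show lp (fun _ : Fin m → ℕ => E) 2 from f)).summable (by simp)
  simp only [ENNReal.toReal_ofNat, Real.rpow_two] at h
  exact h

/-- The element with a given square summable family of normalised coefficients. -/
def ofCoeff (c : (Fin m → ℕ) → E) (hc : Summable fun k => ‖c k‖ ^ 2) : DASpace m E :=
  (⟨c, memℓp_gen (by simpa using hc)⟩ : lp (fun _ : Fin m → ℕ => E) 2)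

theorem coeff_ofCoeff (c : (Fin m → ℕ) → E) (hc : Summable fun k => ‖c k‖ ^ 2)
    (k : Fin m → ℕ) : (ofCoeff c hc).coeff k = c k := rfl

theorem norm_sq_eq (f : DASpace m E) : HasSum (fun k => ‖f.coeff k‖ ^ 2) (‖f‖ ^ 2) := by
  have h := lp.hasSum_norm (by simp) (show lp (fun _ : Fin m → ℕ => E) 2 from f)
  simp only [ENNReal.toReal_ofNat, Real.rpow_two] at h
  exact h

theorem ext_coeff {f g : DASpace m E} (h : ∀ k, f.coeff k = g.coeff k) : f = g :=
  lp.ext (funext h)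

theorem tsum_le (z : Ball m) (f : DASpace m E) :
    (Summable fun k => ‖wmono z.1 k • f.coeff k‖) ∧
      ∑' k, ‖wmono z.1 k • f.coeff k‖ ≤ Real.sqrt (∑' k, ‖wmono z.1 k‖ ^ 2) * ‖f‖ := by
  have hA : HasSum (fun k => ‖wmono z.1 k‖ ^ (2 : ℝ))
      (Real.sqrt (∑' k, ‖wmono z.1 k‖ ^ 2) ^ (2 : ℝ)) := by
    simp only [Real.rpow_two]
    rw [Real.sq_sqrt (tsum_nonneg fun k => by positivity)]
    exact (summable_wmono_sq z).hasSum
  have hB : HasSum (fun k => ‖f.coeff k‖ ^ (2 : ℝ)) (‖f‖ ^ (2 : ℝ)) := by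
    simp only [Real.rpow_two]
    exact norm_sq_eq f
  obtain ⟨C, -, hC, hs⟩ := Real.inner_le_Lp_mul_Lq_hasSum_of_nonneg Real.HolderConjugate.two_two
    (Real.sqrt_nonneg _) (norm_nonneg f) (fun k => norm_nonneg _) (fun k => norm_nonneg _) hA hB
  simp only [norm_smul]
  exact ⟨hs.summable, hs.tsum_eq.trans_le hC⟩

end

section

variable {m : ℕ} {E : Type*} [NormedAddCommGroup E] [InnerProductSpace ℂ E] [CompleteSpace E]

theorem hasSum_value (z : Ball m) (f : DASpace m E) :
    HasSum (fun k => wmono z.1 k • f.coeff k) (∑' k, wmono z.1 k • f.coeff k) :=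
  (tsum_le z f).1.of_norm.hasSum

/-- Point evaluation `f ↦ f z = ∑ √γ_k z ^ k c_k`. -/
def evalCLM (z : Ball m) : DASpace m E →L[ℂ] E :=
  LinearMap.mkContinuous
    { toFun := fun f => ∑' k, wmono z.1 k • f.coeff k
      map_add' := fun f g => by
        simp only [coeff_add, smul_add]
        exact ((hasSum_value z f).add (hasSum_value z g)).tsum_eq
      map_smul' := fun a f => by
        simp only [coeff_smul, RingHom.id_apply, smul_comm _ a]
        exact ((hasSum_value z f).const_smul a).tsum_eq }
    (Real.sqrt (∑' k, ‖wmono z.1 k‖ ^ 2))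
    fun f => (norm_tsum_le_tsum_norm (tsum_le z f).1).trans (tsum_le z f).2

theorem hasSum_evalCLM (z : Ball m) (f : DASpace m E) :
    HasSum (fun k => wmono z.1 k • f.coeff k) (evalCLM z f) :=
  hasSum_value z f

end

end DASpace

theorem eq_zero_of_hasSum_pow (a : ℕ → ℂ) (r : ℝ) (hr : 0 < r)
    (h : ∀ t : ℂ, ‖t‖ < r → HasSum (fun n => t ^ n * a n) 0) (n : ℕ) : a n = 0 := by
  have hp : HasFPowerSeriesAt (0 : ℂ → ℂ) (FormalMultilinearSeries.ofScalars ℂ a) 0 := by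
    rw [hasFPowerSeriesAt_iff]
    filter_upwards [Metric.ball_mem_nhds (0 : ℂ) hr] with t ht
    simpa [FormalMultilinearSeries.coeff_ofScalars] using h t (by simpa using ht)
  have h0 := congrArg (fun p => FormalMultilinearSeries.coeff p n) hp.eq_zero
  rw [FormalMultilinearSeries.coeff_ofScalars] at h0
  exact h0

theorem mono_smul {m : ℕ} (t : ℂ) (x : EuclideanSpace ℂ (Fin m)) (k : Fin m → ℕ) :
    mono (t • x) k = t ^ (∑ i, k i) * mono x k := by
  simp [mono, mul_pow, Finset.prod_mul_distrib, Finset.prod_pow_eq_pow_sum]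

theorem gam_pos {m : ℕ} (k : Fin m → ℕ) : 0 < gam k := Nat.multinomial_pos _ _

/-- A power series that vanishes on the ball has zero coefficients. -/
theorem coeff_eq_zero {m : ℕ} {E : Type*} [NormedAddCommGroup E] [InnerProductSpace ℂ E]
    (c : (Fin m → ℕ) → E) (h : ∀ z : Ball m, HasSum (fun k => wmono z.1 k • c k) 0)
    (k : Fin m → ℕ) : c k = 0 := by
  classical
  refine ext_inner_left ℂ fun v => ?_
  rw [inner_zero_right]
  let b : (Fin m → ℕ) → ℂ := fun k => (Real.sqrt (gam k) : ℂ) * inner ℂ v (c k)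
  have hb : ∀ z : Ball m, HasSum (fun k => mono z.1 k * b k) 0 := by
    intro z
    have := (h z).mapL (innerSL ℂ v)
    simp only [map_zero, innerSL_apply_apply, inner_smul_right] at this
    refine this.congr_fun fun k => ?_
    simp only [wmono, b]
    ring
  have hd : ∀ (n : ℕ) (x : EuclideanSpace ℂ (Fin m)),
      ∑ k ∈ Finset.piAntidiag Finset.univ n, mono x k * b k = 0 := by
    intro n x
    refine eq_zero_of_hasSum_pow
      (fun n => ∑ k ∈ Finset.piAntidiag Finset.univ n, mono x k * b k) (‖x‖ + 1)⁻¹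
      (by positivity) (fun t ht => ?_) n
    have hx : ‖t • x‖ < 1 := by
      have h1 : 0 < ‖x‖ + 1 := by positivity
      have h2 := mul_lt_mul_of_pos_right ht h1
      rw [inv_mul_cancel₀ h1.ne'] at h2
      rw [norm_smul]
      nlinarith [norm_nonneg t]
    have := hasSum_degree (hb ⟨t • x, by simpa using hx⟩)
    refine this.congr_fun fun n => ?_
    rw [Finset.mul_sum]
    refine Finset.sum_congr rfl fun k hk => ?_
    rw [mono_smul, (Finset.mem_piAntidiag.1 hk).1, mul_assoc]
  have hbk : b k = 0 := by
    let n := ∑ i, k i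
    let e : (Fin m → ℕ) → (Fin m →₀ ℕ) := Finsupp.equivFunOnFinite.symm
    let p : MvPolynomial (Fin m) ℂ :=
      ∑ k ∈ Finset.piAntidiag Finset.univ n, MvPolynomial.monomial (e k) (b k)
    have hp : p = 0 := by
      refine MvPolynomial.funext fun x => ?_
      have := hd n (WithLp.toLp 2 x)
      simp only [p, map_sum, map_zero, MvPolynomial.eval_monomial]
      rw [← this]
      refine Finset.sum_congr rfl fun k _ => ?_
      rw [mul_comm, Finsupp.prod_fintype _ _ (fun i => pow_zero _)]
      rfl
    have h1 := congrArg (MvPolynomial.coeff (e k)) hp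
    simp only [p, MvPolynomial.coeff_sum, MvPolynomial.coeff_monomial, MvPolynomial.coeff_zero,
      e, EmbeddingLike.apply_eq_iff_eq] at h1
    rw [Finset.sum_ite_eq' , if_pos (by simp [n])] at h1
    exact h1
  have hg : (Real.sqrt (gam k) : ℂ) ≠ 0 := by
    have := gam_pos k
    simp only [ne_eq, Complex.ofReal_eq_zero]
    positivity
  exact (mul_eq_zero.1 hbk).resolve_left hg

namespace DASpace

variable {m : ℕ} {E : Type*} [NormedAddCommGroup E] [InnerProductSpace ℂ E] [CompleteSpace E]

/-- The elements of `H²ₘ ⊗ 𝓔` are functions `f z = ∑ √γ_k z ^ k c_k` on the ball. -/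
instance rkhs : RKHS ℂ (DASpace m E) (Ball m) E where
  coeCLM := ContinuousLinearMap.pi evalCLM
  coeCLM_injective := by
    refine (injective_iff_map_eq_zero _).2 fun f hf => ext_coeff fun k => ?_
    refine coeff_eq_zero f.coeff (fun z => ?_) k
    have := hasSum_evalCLM z f
    rwa [show evalCLM z f = 0 from congrFun hf z] at this

theorem hasSum_apply (f : DASpace m E) (z : Ball m) :
    HasSum (fun k => wmono z.1 k • f.coeff k) (f z) :=
  hasSum_evalCLM z f

/-- The reproducing kernel of `H²ₘ ⊗ 𝓔` is `(1 - ∑ zᵢ w̄ᵢ)⁻¹ I`. -/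
theorem kernel_eq (z w : Ball m) (v : E) :
    RKHS.kernel (DASpace m E) z w v = (1 - ∑ i, z.1 i * star (w.1 i))⁻¹ • v := by
  let c : (Fin m → ℕ) → E := fun k => star (wmono w.1 k) • v
  have hc : Summable fun k => ‖c k‖ ^ 2 := by
    simp only [c, norm_smul, norm_star, mul_pow]
    exact (summable_wmono_sq w).mul_right _
  have hker : RKHS.kerFun (DASpace m E) w v = ofCoeff c hc := by
    refine ext_inner_right ℂ fun f => ?_
    rw [RKHS.kerFun_inner]
    have h1 := (hasSum_apply f w).mapL (innerSL ℂ v)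
    have h2 : HasSum (fun k => inner ℂ (c k) (f.coeff k)) (inner ℂ (ofCoeff c hc) f) :=
      lp.hasSum_inner (𝕜 := ℂ) (show lp (fun _ : Fin m → ℕ => E) 2 from ofCoeff c hc)
        (show lp (fun _ : Fin m → ℕ => E) 2 from f)
    refine h1.unique (h2.congr_fun fun k => ?_)
    simp [c, mul_comm]
  rw [← RKHS.kerFun_apply, hker]
  have h1 := hasSum_apply (ofCoeff c hc) z
  have h2 := hasSum_degree h1
  refine h2.unique ?_
  have hlt : ‖∑ i, z.1 i * star (w.1 i)‖ < 1 := by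
    have hz := sum_norm_sq_lt z
    have hw := sum_norm_sq_lt w
    calc ‖∑ i, z.1 i * star (w.1 i)‖ ≤ ∑ i, ‖z.1 i * star (w.1 i)‖ := norm_sum_le _ _
      _ ≤ ∑ i, (‖z.1 i‖ ^ 2 + ‖w.1 i‖ ^ 2) / 2 := by
          refine Finset.sum_le_sum fun i _ => ?_
          rw [norm_mul, norm_star]
          nlinarith [sq_nonneg (‖z.1 i‖ - ‖w.1 i‖)]
      _ < 1 := by
          rw [← Finset.sum_div, Finset.sum_add_distrib]
          linarith
  refine ((hasSum_geometric_of_norm_lt_one hlt).smul_const v).congr_fun fun n => ?_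
  rw [Finset.sum_pow_eq_sum_piAntidiag, Finset.sum_smul]
  refine Finset.sum_congr rfl fun k _ => ?_
  simp only [coeff_ofCoeff, c, smul_smul, wmono, mono, mul_pow, Finset.prod_mul_distrib]
  congr 1
  have hs : (Real.sqrt (gam k) : ℂ) * (Real.sqrt (gam k) : ℂ) = gam k := by
    rw [← Complex.ofReal_mul, Real.mul_self_sqrt (Nat.cast_nonneg _)]
    simp
  rw [star_mul', star_prod]
  simp only [star_pow, RCLike.star_def, Complex.conj_ofReal]
  change _ = (gam k : ℂ) * _
  rw [← hs]
  ring

theorem gam_add_single (k : Fin m → ℕ) (i : Fin m) :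
    gam (k + Pi.single i 1) * (k i + 1) = gam k * (∑ j, k j + 1) := by
  have h1 := Nat.multinomial_spec Finset.univ k
  have h2 := Nat.multinomial_spec Finset.univ (k + Pi.single i 1)
  have h3 : ∑ j, (k + Pi.single i 1 : Fin m → ℕ) j = ∑ j, k j + 1 := by
    simp [Finset.sum_add_distrib]
  have h4 : ∏ j, ((k + Pi.single i 1 : Fin m → ℕ) j).factorial
      = (∏ j, (k j).factorial) * (k i + 1) := by
    rw [← Finset.mul_prod_erase _ _ (Finset.mem_univ i),
      ← Finset.mul_prod_erase _ (fun j => (k j).factorial) (Finset.mem_univ i)]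
    have : ∀ j ∈ Finset.univ.erase i, ((k + Pi.single i 1 : Fin m → ℕ) j).factorial
        = (k j).factorial := by
      intro j hj
      simp [Finset.ne_of_mem_erase hj]
    rw [Finset.prod_congr rfl this]
    simp [Nat.factorial_succ]
    ring
  rw [h3, h4, Nat.factorial_succ, ← h1] at h2
  have hpos : 0 < ∏ j, (k j).factorial := Finset.prod_pos fun j _ => Nat.factorial_pos _
  refine Nat.eq_of_mul_eq_mul_left hpos ?_
  simp only [gam]
  linarith

/-- `H²ₘ ⊗ 𝓔` is invariant under multiplication by the coordinate functions. -/
theorem exists_coord_mul (i : Fin m) (f : DASpace m E) :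
    ∃ g : DASpace m E, ∀ z : Ball m, g z = z.1 i • f z := by
  classical
  let s : (Fin m → ℕ) → (Fin m → ℕ) := fun k => k + Pi.single i 1
  have hs : Function.Injective s := add_left_injective _
  let q : (Fin m → ℕ) → ℝ := fun k => Real.sqrt ((k i + 1 : ℕ) / (∑ j, k j + 1 : ℕ))
  have hq : ∀ k, Real.sqrt (gam (s k)) * q k = Real.sqrt (gam k) := by
    intro k
    have h := congrArg (Nat.cast (R := ℝ)) (gam_add_single k i)
    rw [← Real.sqrt_mul (Nat.cast_nonneg _)]
    congr 1
    rw [Nat.cast_mul, Nat.cast_mul] at h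
    rw [← mul_div_assoc, h, mul_div_assoc, div_self (by positivity), mul_one]
  have hq1 : ∀ k, q k ^ 2 ≤ 1 := by
    intro k
    simp only [q]
    rw [Real.sq_sqrt (by positivity), div_le_one (by positivity)]
    exact_mod_cast Nat.succ_le_succ (Finset.single_le_sum (f := k) (fun _ _ => Nat.zero_le _)
      (Finset.mem_univ i))
  let d : (Fin m → ℕ) → E := fun k => (q k : ℂ) • f.coeff k
  have hd : Summable fun k => ‖d k‖ ^ 2 := by
    refine Summable.of_nonneg_of_le (fun k => by positivity) (fun k => ?_) f.summable_coeff_sq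
    simp only [d, norm_smul, mul_pow, Complex.norm_real, Real.norm_eq_abs, sq_abs]
    exact mul_le_of_le_one_left (by positivity) (hq1 k)
  have hc : Summable fun k => ‖Function.extend s d 0 k‖ ^ 2 := by
    refine (hs.summable_iff fun k hk => ?_).1 ?_
    · rw [Function.extend_apply' _ _ _ hk]
      simp
    · refine hd.congr fun k => ?_
      simp [hs.extend_apply]
  refine ⟨ofCoeff _ hc, fun z => ?_⟩
  have h1 := hasSum_apply (ofCoeff _ hc) z
  refine h1.unique ((hs.hasSum_iff fun k hk => ?_).1 ?_)
  · rw [coeff_ofCoeff, Function.extend_apply' _ _ _ hk]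
    simp
  · refine ((hasSum_apply f z).const_smul (z.1 i)).congr_fun fun k => ?_
    have hm : mono z.1 (s k) = z.1 i * mono z.1 k := by
      simp only [mono, s, Pi.add_apply, pow_add, Finset.prod_mul_distrib]
      rw [mul_comm]
      congr 1
      rw [Finset.prod_eq_single i] <;> simp +contextual
    simp only [Function.comp_apply, coeff_ofCoeff, hs.extend_apply, d, smul_smul, wmono, hm]
    congr 1
    rw [← hq k]
    push_cast
    ring

/-- `H²ₘ ⊗ 𝓔` is invariant under multiplication by polynomials. -/
theorem exists_poly_mul (p : MvPolynomial (Fin m) ℂ) (f : DASpace m E) :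
    ∃ g : DASpace m E, ∀ z : Ball m, g z = MvPolynomial.eval z.1 p • f z := by
  induction p using MvPolynomial.induction_on generalizing f with
  | C a => exact ⟨a • f, fun z => by simp⟩
  | add p q hp hq =>
    obtain ⟨g, hg⟩ := hp f
    obtain ⟨h, hh⟩ := hq f
    exact ⟨g + h, fun z => by simp [hg, hh, add_smul]⟩
  | mul_X p i hp =>
    obtain ⟨g, hg⟩ := hp f
    obtain ⟨h, hh⟩ := exists_coord_mul i g
    exact ⟨h, fun z => by rw [hh, hg, smul_smul, map_mul, MvPolynomial.eval_X, mul_comm]⟩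

instance : SMul (MvPolynomial (Fin m) ℂ) (DASpace m E) where
  smul p f := (exists_poly_mul p f).choose

/-- The module multiplication is multiplication of functions. -/
theorem poly_smul_apply (p : MvPolynomial (Fin m) ℂ) (f : DASpace m E) (z : Ball m) :
    (p • f) z = MvPolynomial.eval z.1 p • f z :=
  (exists_poly_mul p f).choose_spec z

/-- `H²ₘ ⊗ 𝓔` as a module over the algebra `ℂ[z₁, …, zₘ]`. -/
instance : Module (MvPolynomial (Fin m) ℂ) (DASpace m E) where
  one_smul f := RKHS.ext fun z => by simp [poly_smul_apply]
  mul_smul p q f := RKHS.ext fun z => by simp [poly_smul_apply, mul_smul]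
  smul_zero p := RKHS.ext fun z => by simp [poly_smul_apply]
  smul_add p f g := RKHS.ext fun z => by simp [poly_smul_apply]
  add_smul p q f := RKHS.ext fun z => by simp [poly_smul_apply, add_smul]
  zero_smul f := RKHS.ext fun z => by simp [poly_smul_apply]

end DASpace

/-- A multiplier `φ ∈ 𝓜(𝓔, 𝓔')`: an operator-valued function, holomorphic on the ball, such that
`φ f ∈ H²ₘ ⊗ 𝓔'` for all `f ∈ H²ₘ ⊗ 𝓔`. Only the values of `φ` on the ball matter. -/
structure Multiplier (m : ℕ) (E E' : Type*) [NormedAddCommGroup E] [InnerProductSpace ℂ E]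
    [CompleteSpace E] [NormedAddCommGroup E'] [InnerProductSpace ℂ E'] [CompleteSpace E'] where
  toFun : EuclideanSpace ℂ (Fin m) → E →L[ℂ] E'
  holomorphic : DifferentiableOn ℂ toFun (Metric.ball 0 1)
  exists_mul : ∀ f : DASpace m E, ∃ g : DASpace m E', ∀ z : Ball m, g z = toFun z.1 (f z)

namespace Multiplier

variable {m : ℕ} {E E' : Type*} [NormedAddCommGroup E] [InnerProductSpace ℂ E] [CompleteSpace E]
  [NormedAddCommGroup E'] [InnerProductSpace ℂ E'] [CompleteSpace E']

/-- The function `φ f` as an element of `H²ₘ ⊗ 𝓔'`. -/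
def mulFun (φ : Multiplier m E E') (f : DASpace m E) : DASpace m E' := (φ.exists_mul f).choose

theorem mulFun_apply (φ : Multiplier m E E') (f : DASpace m E) (z : Ball m) :
    φ.mulFun f z = φ.toFun z.1 (f z) :=
  (φ.exists_mul f).choose_spec z

theorem continuous_mulFun (φ : Multiplier m E E') : Continuous φ.mulFun := by
  let T : DASpace m E →ₗ[ℂ] DASpace m E' :=
    { toFun := φ.mulFun
      map_add' := fun f g => RKHS.ext fun z => by simp [mulFun_apply]
      map_smul' := fun a f => RKHS.ext fun z => by simp [mulFun_apply] }
  refine T.continuous_of_seq_closed_graph fun u f g hu hTu => RKHS.ext fun z => ?_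
  have h1 := ((RKHS.continuous_eval (H := DASpace m E') z).tendsto g).comp hTu
  have h2 := ((φ.toFun z.1).continuous.tendsto _).comp
    (((RKHS.continuous_eval (H := DASpace m E) z).tendsto f).comp hu)
  refine (tendsto_nhds_unique h1 (h2.congr fun n => ?_)).trans (φ.mulFun_apply f z).symm
  exact (φ.mulFun_apply (u n) z).symm

/-- The bounded module map `M_φ f = φ f`. -/
def mulOp (φ : Multiplier m E E') :
    DASpace m E →L[MvPolynomial (Fin m) ℂ] DASpace m E' where
  toFun := φ.mulFun
  map_add' f g := RKHS.ext fun z => by simp [mulFun_apply]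
  map_smul' p f := RKHS.ext fun z => by simp [mulFun_apply, DASpace.poly_smul_apply]
  cont := φ.continuous_mulFun

theorem mulOp_apply (φ : Multiplier m E E') (f : DASpace m E) (z : Ball m) :
    φ.mulOp f z = φ.toFun z.1 (f z) :=
  φ.mulFun_apply f z

/-- The submodule `ran M_φ` of `H²ₘ ⊗ 𝓔'`. -/
def ran (φ : Multiplier m E E') : Submodule (MvPolynomial (Fin m) ℂ) (DASpace m E') :=
  LinearMap.range φ.mulOp.toLinearMap

/-- The quotient module `𝓗_φ = (H²ₘ ⊗ 𝓔') / ran M_φ`, with its quotient topology. -/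
abbrev QuotientModule (φ : Multiplier m E E') : Type _ := DASpace m E' ⧸ φ.ran

/-- The quotient map `π_φ : H²ₘ ⊗ 𝓔' → 𝓗_φ`. -/
abbrev quotientMap (φ : Multiplier m E E') :
    DASpace m E' →L[MvPolynomial (Fin m) ℂ] φ.QuotientModule := φ.ran.mkQL

/-- The sequence `H²ₘ ⊗ 𝓔 → H²ₘ ⊗ 𝓔' → 𝓗_φ → 0` splits: `π_φ` has a right inverse that is a
bounded module map. -/
def SequenceSplits (φ : Multiplier m E E') : Prop :=
  ∃ σ : φ.QuotientModule →L[MvPolynomial (Fin m) ℂ] DASpace m E',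
    φ.quotientMap.comp σ = ContinuousLinearMap.id (MvPolynomial (Fin m) ℂ) φ.QuotientModule

end Multiplier

/-- Two topological modules over `ℂ[z₁, …, zₘ]` are similar if there is an invertible bounded
module map between them. -/
def Similar (m : ℕ) (M N : Type*) [AddCommGroup M] [TopologicalSpace M]
    [Module (MvPolynomial (Fin m) ℂ) M] [AddCommGroup N] [TopologicalSpace N]
    [Module (MvPolynomial (Fin m) ℂ) N] : Prop :=
  Nonempty (M ≃L[MvPolynomial (Fin m) ℂ] N)

/-- `M = S₁ ∔ S₂`: the module `M` is the skew direct sum of the closed submodules `S₁`, `S₂`. -/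
def IsSkewDirectSum {m : ℕ} {M : Type*} [AddCommGroup M] [TopologicalSpace M]
    [Module (MvPolynomial (Fin m) ℂ) M] (S₁ S₂ : Submodule (MvPolynomial (Fin m) ℂ) M) : Prop :=
  IsClosed (S₁ : Set M) ∧ IsClosed (S₂ : Set M) ∧ IsCompl S₁ S₂

/-- The submodule `S` is complemented in `M`: `M = S ∔ S'` for some closed submodule `S'`. -/
def IsComplemented {m : ℕ} {M : Type*} [AddCommGroup M] [TopologicalSpace M]
    [Module (MvPolynomial (Fin m) ℂ) M] (S : Submodule (MvPolynomial (Fin m) ℂ) M) : Prop :=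
  ∃ S' : Submodule (MvPolynomial (Fin m) ℂ) M, IsSkewDirectSum S S'

end DruryArveson

end

/-!
A similarity `X : 𝓗_θ → H²ₘ ⊗ 𝓕` has an inverse `X⁻¹ : H²ₘ ⊗ 𝓕 → (H²ₘ ⊗ 𝓔') / ran M_θ`. If `X⁻¹`
lifts to a multiplier, that is, `X⁻¹ = π_θ M_φ`, then `σ = M_φ X` is a right inverse of `π_θ` by a
bounded module map. Its range is `ran M_φ = {g | σ π_θ g = g}`, which is closed and complementary to
`ker π_θ = ran M_θ`. This gives all the conclusions, so the substance is that module maps out of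
`H²ₘ ⊗ 𝓕` into the quotient lift (`exists_multiplier_lift`), which is an instance of the commutant
lifting theorem for the Drury–Arveson space (`exists_multiplier_sub_mem`).

Commutant lifting is proved by the lurking isometry method. Write `Bᵢ` for the adjoint of
multiplication by `zᵢ`; then `‖f‖² = ‖f 0‖² + ∑ ‖Bᵢ f‖²`. Let `N` be a closed invariant subspace,
let `R` be a contraction that intertwines the shifts modulo `N`, and let `Q* Q = 1 - R R*`. On the
coinvariant subspace `Nᗮ` the operator `R*` commutes with the `Bᵢ`, and therefore
`‖Q k‖² + ‖(R* k) 0‖² = ∑ ‖Q Bᵢ k‖² + ‖k 0‖²`. So `(Q Bᵢ k)ᵢ ⊕ k 0 ↦ Q k ⊕ (R* k) 0` is an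
isometry, which extends to a contraction; let `W : 𝓓 ⊕ 𝓕 → 𝓓ᵐ ⊕ 𝓔` be its adjoint
(`exists_lurking_contraction`).

The contraction `W` turns the space `𝓓 ⊕ (H²ₘ ⊗ 𝓕)` into the state space of a contractive column
`(c, A₁, …, Aₘ)`, with `Aᵢ (d, f) = (Wᵢ (d, f 0), Bᵢ f)` and `c (d, f) = W_𝓔 (d, f 0)`. Such a
column, whose entries need not commute, has a contractive observability operator
`J x = c x + ∑ zᵢ J (Aᵢ x)` (`exists_observability`). Evaluating this equation at a point of
the ball shows that `f ↦ J (0, f)` is multiplication by the transfer function `φ` of `W`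
(`exists_transfer_multiplier`). On the other hand `J*` and `k ↦ (Q k, R* k)` satisfy the same
equation along the backward shifts on `Nᗮ`. Such an equation has only one bounded solution
(`eq_zero_of_inner_eq_sum_backShift`), since its solutions are controlled by the tails of the power
series `k`; hence `R* = M_φ*` on `Nᗮ`, that is, `R` and `M_φ` agree modulo `N`.
-/

noncomputable section

namespace DruryArveson

section

variable {m : ℕ} {X E : Type*} [NormedAddCommGroup X] [InnerProductSpace ℂ X]
  [NormedAddCommGroup E] [InnerProductSpace ℂ E]

/-! ### The coordinate shifts and their adjoints -/

/-- The weight `√(jᵢ / |j|)` of the coordinate shift: multiplication by `zᵢ` takes the normalised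
monomial of index `j - eᵢ` to `√(jᵢ / |j|)` times that of index `j`. At `j = 0` its value is `0`. -/
def shiftWeight (i : Fin m) (j : Fin m → ℕ) : ℝ := Real.sqrt ((j i : ℝ) / ((∑ l, j l : ℕ) : ℝ))

theorem shiftWeight_eq_zero {i : Fin m} {j : Fin m → ℕ} (h : j i = 0) : shiftWeight i j = 0 := by
  simp [shiftWeight, h]

theorem shiftWeight_sq (i : Fin m) (j : Fin m → ℕ) :
    shiftWeight i j ^ 2 = (j i : ℝ) / ((∑ l, j l : ℕ) : ℝ) :=
  Real.sq_sqrt (by positivity)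

theorem shiftWeight_sq_le_one (i : Fin m) (j : Fin m → ℕ) : shiftWeight i j ^ 2 ≤ 1 := by
  rw [shiftWeight_sq]
  refine div_le_one_of_le₀ ?_ (Nat.cast_nonneg _)
  exact_mod_cast Finset.single_le_sum (f := j) (fun _ _ => Nat.zero_le _) (Finset.mem_univ i)

theorem sum_shiftWeight_sq {j : Fin m → ℕ} (hj : j ≠ 0) : ∑ i, shiftWeight i j ^ 2 = 1 := by
  simp only [shiftWeight_sq]
  rw [← Finset.sum_div, ← Nat.cast_sum, div_self]
  rw [Nat.cast_ne_zero]
  intro h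
  exact hj (funext fun i => Finset.sum_eq_zero_iff.1 h i (Finset.mem_univ i))

theorem sub_single_add_single {i : Fin m} {j : Fin m → ℕ} (h : j i ≠ 0) :
    j - Pi.single i 1 + Pi.single i 1 = j := by
  refine tsub_add_cancel_of_le fun l => ?_
  rcases eq_or_ne l i with rfl | hl
  · simpa using Nat.one_le_iff_ne_zero.2 h
  · simp [hl]

/-- Reindexing along `k ↦ k + eᵢ`, for a family supported in the range of this map. -/
theorem hasSum_add_single_iff {V : Type*} [AddCommMonoid V] [TopologicalSpace V] (i : Fin m)
    {g : (Fin m → ℕ) → V} (hg : ∀ j, j i = 0 → g j = 0) {a : V} :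
    HasSum (fun k : Fin m → ℕ => g (k + Pi.single i 1)) a ↔ HasSum g a := by
  refine Function.Injective.hasSum_iff (g := fun k : Fin m → ℕ => k + Pi.single i 1)
    (add_left_injective _) fun j hj => hg j ?_
  by_contra h
  exact hj ⟨_, sub_single_add_single h⟩

namespace DASpace

/-- A linear family of coefficients whose square sums are bounded by `‖x‖²` defines a contraction
into `H²ₘ ⊗ 𝓔`. -/
def ofCoeffCLM (c : X →ₗ[ℂ] ((Fin m → ℕ) → E))
    (hc : ∀ x (s : Finset (Fin m → ℕ)), ∑ k ∈ s, ‖c x k‖ ^ 2 ≤ ‖x‖ ^ 2) :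
    X →L[ℂ] DASpace m E :=
  LinearMap.mkContinuous
    { toFun := fun x => ofCoeff (c x) (summable_of_sum_le (fun _ => sq_nonneg _) (hc x))
      map_add' := fun x y => ext_coeff fun k => by simp [coeff_add, coeff_ofCoeff]
      map_smul' := fun a x => ext_coeff fun k => by simp [coeff_smul, coeff_ofCoeff] }
    1 fun x => by
      rw [one_mul]
      refine le_of_sq_le_sq ?_ (norm_nonneg x)
      exact (hasSum_le_of_sum_le (norm_sq_eq _) (hc x))

@[simp]
theorem coeff_ofCoeffCLM (c : X →ₗ[ℂ] ((Fin m → ℕ) → E))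
    (hc : ∀ x (s : Finset (Fin m → ℕ)), ∑ k ∈ s, ‖c x k‖ ^ 2 ≤ ‖x‖ ^ 2) (x : X) (k : Fin m → ℕ) :
    (ofCoeffCLM c hc x).coeff k = c x k := rfl

theorem sum_norm_coeff_sq_le (f : DASpace m E) (s : Finset (Fin m → ℕ)) :
    ∑ k ∈ s, ‖f.coeff k‖ ^ 2 ≤ ‖f‖ ^ 2 :=
  sum_le_hasSum s (fun _ _ => sq_nonneg _) (norm_sq_eq f)

theorem hasSum_inner_coeff (f g : DASpace m E) :
    HasSum (fun k => inner ℂ (f.coeff k) (g.coeff k)) (inner ℂ f g) :=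
  lp.hasSum_inner (𝕜 := ℂ) (show lp (fun _ : Fin m → ℕ => E) 2 from f)
    (show lp (fun _ : Fin m → ℕ => E) 2 from g)

/-- The `k`-th normalised coefficient as a continuous linear map. -/
def coeffCLM (k : Fin m → ℕ) : DASpace m E →L[ℂ] E :=
  LinearMap.mkContinuous
    { toFun := fun f => f.coeff k
      map_add' := fun f g => coeff_add f g k
      map_smul' := fun a f => coeff_smul a f k } 1 fun f => by
    rw [one_mul]
    refine le_of_sq_le_sq ?_ (norm_nonneg f)
    simpa using sum_norm_coeff_sq_le f {k}

@[simp]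
theorem coeffCLM_apply (k : Fin m → ℕ) (f : DASpace m E) : coeffCLM k f = f.coeff k := rfl

theorem coeff_sum {ι : Type*} (s : Finset ι) (f : ι → DASpace m E) (k : Fin m → ℕ) :
    (∑ i ∈ s, f i).coeff k = ∑ i ∈ s, (f i).coeff k :=
  map_sum (coeffCLM k) f s

/-- The constant functions in `H²ₘ ⊗ 𝓔`. -/
def const : E →L[ℂ] DASpace m E :=
  ofCoeffCLM (LinearMap.single ℂ (fun _ : Fin m → ℕ => E) 0) fun v s => by
    have h : ∀ k : Fin m → ℕ, ‖(Pi.single 0 v : (Fin m → ℕ) → E) k‖ ^ 2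
        = if k = 0 then ‖v‖ ^ 2 else 0 := by
      intro k
      by_cases hk : k = 0
      · subst hk
        simp
      · simp [hk]
    simp only [LinearMap.coe_single, h, Finset.sum_ite_eq']
    split_ifs
    · exact le_rfl
    · positivity

theorem coeff_const (v : E) (k : Fin m → ℕ) :
    (const v : DASpace m E).coeff k = if k = 0 then v else 0 := by
  simp [const, Pi.single_apply]

/-- Multiplication by the coordinate `zᵢ`, given by its action on the coefficients. -/
def shift (i : Fin m) : DASpace m E →L[ℂ] DASpace m E :=
  ofCoeffCLM
    { toFun := fun f j => (shiftWeight i j : ℂ) • f.coeff (j - Pi.single i 1)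
      map_add' := fun f g => by ext; simp [coeff_add]
      map_smul' := fun a f => by ext; simp [coeff_smul, smul_comm a] } fun f s => by
    have h1 : Summable fun k => shiftWeight i (k + Pi.single i 1) ^ 2 * ‖f.coeff k‖ ^ 2 :=
      Summable.of_nonneg_of_le (fun k => by positivity)
        (fun k => mul_le_of_le_one_left (sq_nonneg _) (shiftWeight_sq_le_one i _))
        f.summable_coeff_sq
    have h2 := (hasSum_add_single_iff i
      (g := fun j => shiftWeight i j ^ 2 * ‖f.coeff (j - Pi.single i 1)‖ ^ 2)
      (fun j hj => by simp [shiftWeight_eq_zero hj])).1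
      (by simpa only [add_tsub_cancel_right] using h1.hasSum)
    simp only [LinearMap.coe_mk, AddHom.coe_mk, norm_smul, mul_pow, Complex.norm_real,
      Real.norm_eq_abs, sq_abs]
    refine (sum_le_hasSum s (fun _ _ => by positivity) h2).trans ?_
    exact hasSum_le (fun k => mul_le_of_le_one_left (sq_nonneg _) (shiftWeight_sq_le_one i _))
      h1.hasSum (norm_sq_eq f)

theorem coeff_shift (i : Fin m) (f : DASpace m E) (j : Fin m → ℕ) :
    (shift i f).coeff j = (shiftWeight i j : ℂ) • f.coeff (j - Pi.single i 1) := rfl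

/-- The adjoint of multiplication by `zᵢ`, given by its action on the coefficients. -/
def backShift (i : Fin m) : DASpace m E →L[ℂ] DASpace m E :=
  ofCoeffCLM
    { toFun := fun f k => (shiftWeight i (k + Pi.single i 1) : ℂ) • f.coeff (k + Pi.single i 1)
      map_add' := fun f g => by ext; simp [coeff_add]
      map_smul' := fun a f => by ext; simp [coeff_smul, smul_comm a] } fun f s => by
    simp only [LinearMap.coe_mk, AddHom.coe_mk, norm_smul, mul_pow, Complex.norm_real,
      Real.norm_eq_abs, sq_abs]
    calc _ ≤ ∑ k ∈ s, ‖f.coeff (k + Pi.single i 1)‖ ^ 2 := Finset.sum_le_sum fun k _ =>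
          mul_le_of_le_one_left (sq_nonneg _) (shiftWeight_sq_le_one i _)
      _ = ∑ j ∈ s.map (addRightEmbedding (Pi.single i 1)), ‖f.coeff j‖ ^ 2 := by simp
      _ ≤ _ := sum_norm_coeff_sq_le f _

theorem coeff_backShift (i : Fin m) (f : DASpace m E) (k : Fin m → ℕ) :
    (backShift i f).coeff k
      = (shiftWeight i (k + Pi.single i 1) : ℂ) • f.coeff (k + Pi.single i 1) := rfl

theorem backShift_const (i : Fin m) (v : E) : backShift i (const v : DASpace m E) = 0 :=
  ext_coeff fun k => by
    have h : k + Pi.single i 1 ≠ 0 := fun h => by simpa using congrFun h i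
    rw [coeff_backShift, coeff_const, if_neg h, smul_zero]
    rfl

theorem inner_shift_left (i : Fin m) (f g : DASpace m E) :
    inner ℂ (shift i f) g = inner ℂ f (backShift i g) := by
  refine (hasSum_inner_coeff _ _).unique ((hasSum_add_single_iff i fun j hj => ?_).1 ?_)
  · simp [coeff_shift, shiftWeight_eq_zero hj]
  · refine (hasSum_inner_coeff f (backShift i g)).congr_fun fun k => ?_
    simp [coeff_shift, coeff_backShift]

theorem inner_const_left (v : E) (f : DASpace m E) :
    inner ℂ (const v) f = inner ℂ v (f.coeff 0) := by
  refine (hasSum_inner_coeff _ _).unique ?_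
  have h := hasSum_ite_eq (0 : Fin m → ℕ) (inner ℂ v (f.coeff 0))
  refine h.congr_fun fun k => ?_
  rw [coeff_const]
  split_ifs with hk
  · rw [hk]
  · simp

/-- Every function is its value at the origin plus `∑ zᵢ (Bᵢ f)`, where `Bᵢ` is the backward
shift. -/
theorem eq_const_add_sum_shift (f : DASpace m E) :
    f = const (f.coeff 0) + ∑ i, shift i (backShift i f) := by
  refine ext_coeff fun j => ?_
  rw [coeff_add, coeff_sum, coeff_const]
  have h : ∀ i, (shift i (backShift i f)).coeff j
      = ((shiftWeight i j ^ 2 : ℝ) : ℂ) • f.coeff j := by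
    intro i
    rw [coeff_shift, coeff_backShift]
    by_cases hj : j i = 0
    · simp [shiftWeight_eq_zero hj]
    · rw [sub_single_add_single hj, smul_smul, sq, Complex.ofReal_mul]
  simp only [h, ← Finset.sum_smul, ← Complex.ofReal_sum]
  by_cases hj : j = 0
  · subst hj
    simp [shiftWeight]
  · simp [sum_shiftWeight_sq hj, hj]

theorem inner_eq_add_sum_backShift (f g : DASpace m E) :
    inner ℂ f g = inner ℂ (f.coeff 0) (g.coeff 0)
      + ∑ i, inner ℂ (backShift i f) (backShift i g) := by
  conv_lhs => rw [eq_const_add_sum_shift f]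
  simp only [inner_add_left, sum_inner, inner_const_left, inner_shift_left]

theorem norm_sq_eq_add_sum_backShift (f : DASpace m E) :
    ‖f‖ ^ 2 = ‖f.coeff 0‖ ^ 2 + ∑ i, ‖backShift i f‖ ^ 2 := by
  have h := inner_eq_add_sum_backShift f f
  simp only [inner_self_eq_norm_sq_to_K] at h
  exact_mod_cast h

theorem sum_norm_backShift_sq_le (f : DASpace m E) : ∑ i, ‖backShift i f‖ ^ 2 ≤ ‖f‖ ^ 2 := by
  rw [norm_sq_eq_add_sum_backShift f]
  exact le_add_of_nonneg_left (sq_nonneg _)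

/-- The row `(v, f₁, …, fₘ) ↦ v + ∑ zᵢ fᵢ` is a contraction. -/
theorem norm_const_add_sum_shift_sq_le (v : E) (f : Fin m → DASpace m E) :
    ‖const v + ∑ i, shift i (f i)‖ ^ 2 ≤ ‖v‖ ^ 2 + ∑ i, ‖f i‖ ^ 2 := by
  set h := const v + ∑ i, shift i (f i) with hh
  -- Pairing the sum `h` with itself moves the shifts to the other side, where
  -- `‖h 0‖² + ∑ ‖Bᵢ h‖² = ‖h‖²`.
  have h1 : inner ℂ h h = inner ℂ v (h.coeff 0) + ∑ i, inner ℂ (f i) (backShift i h) := by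
    conv_lhs => enter [2]; rw [hh]
    simp only [inner_add_left, sum_inner, inner_const_left, inner_shift_left]
  have h2 : ‖h‖ ^ 2 ≤ ‖v‖ * ‖h.coeff 0‖ + ∑ i, ‖f i‖ * ‖backShift i h‖ := by
    have : ‖h‖ ^ 2 = ‖(inner ℂ h h : ℂ)‖ := by
      rw [inner_self_eq_norm_sq_to_K]
      simp
    rw [this, h1]
    refine (norm_add_le _ _).trans (add_le_add (norm_inner_le_norm _ _) ?_)
    exact (norm_sum_le _ _).trans (Finset.sum_le_sum fun i _ => norm_inner_le_norm _ _)
  have h3 : ∑ i, ‖f i‖ * ‖backShift i h‖ ≤ ∑ i, (‖f i‖ ^ 2 + ‖backShift i h‖ ^ 2) / 2 :=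
    Finset.sum_le_sum fun i _ => by nlinarith [sq_nonneg (‖f i‖ - ‖backShift i h‖)]
  rw [← Finset.sum_div, Finset.sum_add_distrib] at h3
  nlinarith [sq_nonneg (‖v‖ - ‖h.coeff 0‖), norm_sq_eq_add_sum_backShift h]

section tail

/-- The square norm of the part of `f` of degree at least `n`. -/
def tail (n : ℕ) (f : DASpace m E) : ℝ := ∑' k, if n ≤ ∑ i, k i then ‖f.coeff k‖ ^ 2 else 0

theorem hasSum_tail (n : ℕ) (f : DASpace m E) :
    HasSum (fun k => if n ≤ ∑ i, k i then ‖f.coeff k‖ ^ 2 else 0) (tail n f) := by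
  refine (Summable.of_nonneg_of_le (fun k => ?_) (fun k => ?_) f.summable_coeff_sq).hasSum
  · split_ifs <;> positivity
  · split_ifs <;> simp

theorem tail_zero (f : DASpace m E) : tail 0 f = ‖f‖ ^ 2 := by
  refine (hasSum_tail 0 f).unique ?_
  simpa using norm_sq_eq f

theorem sum_tail_backShift (n : ℕ) (f : DASpace m E) :
    ∑ i, tail n (backShift i f) = tail (n + 1) f := by
  have h : ∀ i, HasSum (fun j => shiftWeight i j ^ 2 *
      if n + 1 ≤ ∑ l, j l then ‖f.coeff j‖ ^ 2 else 0) (tail n (backShift i f)) := by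
    intro i
    refine (hasSum_add_single_iff i fun j hj => by simp [shiftWeight_eq_zero hj]).1 ?_
    refine (hasSum_tail n (backShift i f)).congr_fun fun k => ?_
    have : ∑ l, (k + Pi.single i 1 : Fin m → ℕ) l = ∑ l, k l + 1 := by
      simp [Finset.sum_add_distrib]
    rw [this, coeff_backShift]
    simp [norm_smul, mul_pow]
  refine (hasSum_sum fun i _ => h i).unique ((hasSum_tail (n + 1) f).congr_fun fun j => ?_)
  rw [← Finset.sum_mul]
  by_cases hj : j = 0
  · simp [hj]
  · rw [sum_shiftWeight_sq hj, one_mul]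

theorem tendsto_tail (f : DASpace m E) :
    Filter.Tendsto (fun n => tail n f) Filter.atTop (nhds 0) := by
  have h := tendsto_tsum_of_dominated_convergence (𝓕 := Filter.atTop)
    (f := fun (n : ℕ) (k : Fin m → ℕ) => if n ≤ ∑ i, k i then ‖f.coeff k‖ ^ 2 else 0)
    (g := fun _ => (0 : ℝ)) f.summable_coeff_sq (fun k => ?_) (.of_forall fun n k => ?_)
  · simpa [tail] using h
  · refine tendsto_const_nhds.congr' ?_
    filter_upwards [Filter.eventually_gt_atTop (∑ i, k i)] with n hn
    rw [if_neg (not_le.2 hn)]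
  · split_ifs <;> simp

end tail

section eval

variable [CompleteSpace E]

theorem const_apply (v : E) (z : Ball m) : (const v : DASpace m E) z = v := by
  refine (hasSum_apply _ z).unique ?_
  refine (hasSum_ite_eq (0 : Fin m → ℕ) v).congr_fun fun k => ?_
  rw [coeff_const]
  split_ifs with hk
  · simp [hk, wmono, mono, gam, Nat.multinomial]
  · simp

theorem shift_apply (i : Fin m) (f : DASpace m E) (z : Ball m) : shift i f z = z.1 i • f z := by
  refine (hasSum_apply _ z).unique ((hasSum_add_single_iff i fun j hj => ?_).1 ?_)
  · simp [coeff_shift, shiftWeight_eq_zero hj]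
  · refine ((hasSum_apply f z).const_smul (z.1 i)).congr_fun fun k => ?_
    have hs : ∑ l, (k + Pi.single i 1 : Fin m → ℕ) l = ∑ l, k l + 1 := by
      simp [Finset.sum_add_distrib]
    have hq : Real.sqrt (gam (k + Pi.single i 1)) * shiftWeight i (k + Pi.single i 1)
        = Real.sqrt (gam k) := by
      have h := congrArg (Nat.cast (R := ℝ)) (gam_add_single k i)
      rw [shiftWeight, ← Real.sqrt_mul (Nat.cast_nonneg _), hs, Pi.add_apply, Pi.single_eq_same]
      congr 1
      rw [Nat.cast_mul, Nat.cast_mul] at h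
      rw [← mul_div_assoc, h, mul_div_assoc, div_self (by positivity), mul_one]
    have hm : mono z.1 (k + Pi.single i 1) = z.1 i * mono z.1 k := by
      simp only [mono, Pi.add_apply, pow_add, Finset.prod_mul_distrib]
      rw [mul_comm]
      congr 1
      rw [Finset.prod_eq_single i] <;> simp +contextual
    rw [coeff_shift, add_tsub_cancel_right, smul_smul, smul_smul, wmono, wmono, hm, ← hq]
    congr 1
    push_cast
    ring

theorem evalCLM_apply (z : Ball m) (f : DASpace m E) : evalCLM z f = f z := rfl

theorem evalCLM_eq_add_sum (z : Ball m) (f : DASpace m E) :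
    evalCLM z f = f.coeff 0 + ∑ i, z.1 i • evalCLM z (backShift i f) := by
  conv_lhs => rw [eq_const_add_sum_shift f]
  simp only [map_add, map_sum]
  simp only [evalCLM_apply, const_apply, shift_apply]

theorem X_smul (i : Fin m) (f : DASpace m E) :
    (MvPolynomial.X i : MvPolynomial (Fin m) ℂ) • f = shift i f :=
  RKHS.ext fun z => by simp [poly_smul_apply, shift_apply]

theorem C_smul (a : ℂ) (f : DASpace m E) :
    (MvPolynomial.C a : MvPolynomial (Fin m) ℂ) • f = a • f :=
  RKHS.ext fun z => by simp [poly_smul_apply]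

end eval

end DASpace

end

section

variable {m : ℕ} {X E : Type*} [NormedAddCommGroup X] [InnerProductSpace ℂ X]
  [NormedAddCommGroup E] [InnerProductSpace ℂ E]

namespace DASpace

/-! ### The observability operator -/

/-- The polynomial approximations of the observability operator: the part of degree less than `n` of
`x ↦ c (1 - ∑ zᵢ Aᵢ)⁻¹ x`. -/
def obsApprox (A : Fin m → X →L[ℂ] X) (c : X →L[ℂ] E) : ℕ → (X →ₗ[ℂ] DASpace m E)
  | 0 => 0
  | n + 1 => const.toLinearMap ∘ₗ c.toLinearMap
      + ∑ i, (shift i).toLinearMap ∘ₗ obsApprox A c n ∘ₗ (A i).toLinearMap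

variable {A : Fin m → X →L[ℂ] X} {c : X →L[ℂ] E}

theorem obsApprox_succ_apply (n : ℕ) (x : X) :
    obsApprox A c (n + 1) x = const (c x) + ∑ i, shift i (obsApprox A c n (A i x)) := by
  simp [obsApprox]

theorem norm_obsApprox_sq_le (h : ∀ x, ‖c x‖ ^ 2 + ∑ i, ‖A i x‖ ^ 2 ≤ ‖x‖ ^ 2) (n : ℕ) (x : X) :
    ‖obsApprox A c n x‖ ^ 2 ≤ ‖x‖ ^ 2 := by
  induction n generalizing x with
  | zero => simp [obsApprox]
  | succ n ih =>
    rw [obsApprox_succ_apply]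
    refine (norm_const_add_sum_shift_sq_le _ _).trans (le_trans ?_ (h x))
    exact add_le_add_right (Finset.sum_le_sum fun i _ => ih _) _

theorem coeff_obsApprox_succ (n : ℕ) (x : X) (j : Fin m → ℕ) :
    (obsApprox A c (n + 1) x).coeff j = (const (c x) : DASpace m E).coeff j
      + ∑ i, (shiftWeight i j : ℂ) • (obsApprox A c n (A i x)).coeff (j - Pi.single i 1) := by
  simp only [obsApprox_succ_apply, coeff_add, coeff_sum, coeff_shift]

theorem degree_sub_single_add_one {i : Fin m} {j : Fin m → ℕ} (h : j i ≠ 0) :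
    ∑ l, (j - Pi.single i 1 : Fin m → ℕ) l + 1 = ∑ l, j l := by
  conv_rhs => rw [← sub_single_add_single h]
  simp only [Pi.add_apply, Finset.sum_add_distrib]
  simp

theorem coeff_obsApprox_eq (n : ℕ) (x : X) (j : Fin m → ℕ) (hj : ∑ i, j i < n) :
    (obsApprox A c n x).coeff j = (obsApprox A c (∑ i, j i + 1) x).coeff j := by
  induction n generalizing x j with
  | zero => simp at hj
  | succ n ih =>
    rw [coeff_obsApprox_succ, coeff_obsApprox_succ]
    congr 1
    refine Finset.sum_congr rfl fun i _ => ?_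
    by_cases h : j i = 0
    · simp [shiftWeight_eq_zero h]
    · have hd := degree_sub_single_add_one h
      rw [ih _ _ (by omega), hd]

/-- The coefficients of the observability operator, which are those of its polynomial
approximations of sufficiently large degree. -/
def obsCoeff (A : Fin m → X →L[ℂ] X) (c : X →L[ℂ] E) : X →ₗ[ℂ] ((Fin m → ℕ) → E) :=
  LinearMap.pi fun j => (coeffCLM j).toLinearMap ∘ₗ obsApprox A c (∑ i, j i + 1)

theorem obsCoeff_apply (x : X) (j : Fin m → ℕ) :
    obsCoeff A c x j = (obsApprox A c (∑ i, j i + 1) x).coeff j := by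
  simp only [obsCoeff, LinearMap.pi_apply, LinearMap.comp_apply, ContinuousLinearMap.coe_coe,
    coeffCLM_apply]

theorem sum_norm_obsCoeff_sq_le (h : ∀ x, ‖c x‖ ^ 2 + ∑ i, ‖A i x‖ ^ 2 ≤ ‖x‖ ^ 2) (x : X)
    (s : Finset (Fin m → ℕ)) : ∑ j ∈ s, ‖obsCoeff A c x j‖ ^ 2 ≤ ‖x‖ ^ 2 := by
  obtain ⟨N, hN⟩ : ∃ N, ∀ j ∈ s, ∑ i, j i < N :=
    ⟨s.sup (fun j => ∑ i, j i) + 1, fun j hj =>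
      Nat.lt_add_one_of_le (Finset.le_sup (f := fun j : Fin m → ℕ => ∑ i, j i) hj)⟩
  have e : ∀ j ∈ s, ‖obsCoeff A c x j‖ ^ 2 = ‖(obsApprox A c N x).coeff j‖ ^ 2 := fun j hj => by
    rw [coeff_obsApprox_eq N x j (hN j hj), obsCoeff_apply]
  rw [Finset.sum_congr rfl e]
  exact (sum_norm_coeff_sq_le _ s).trans (norm_obsApprox_sq_le h _ x)

theorem obsCoeff_eq (x : X) (j : Fin m → ℕ) :
    obsCoeff A c x j = (const (c x) : DASpace m E).coeff j
      + ∑ i, (shiftWeight i j : ℂ) • obsCoeff A c (A i x) (j - Pi.single i 1) := by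
  rw [obsCoeff_apply, coeff_obsApprox_succ]
  congr 1
  refine Finset.sum_congr rfl fun i _ => ?_
  by_cases hi : j i = 0
  · simp [shiftWeight_eq_zero hi]
  · rw [obsCoeff_apply, degree_sub_single_add_one hi]

/-- The observability operator `x ↦ c (1 - ∑ zᵢ Aᵢ)⁻¹ x` of a contractive column
`(c, A₁, …, Aₘ)` is a contraction into `H²ₘ ⊗ 𝓔`. The operators `Aᵢ` need not commute. -/
theorem exists_observability (h : ∀ x, ‖c x‖ ^ 2 + ∑ i, ‖A i x‖ ^ 2 ≤ ‖x‖ ^ 2) :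
    ∃ J : X →L[ℂ] DASpace m E, ∀ x, J x = const (c x) + ∑ i, shift i (J (A i x)) := by
  obtain ⟨J, hJ⟩ : ∃ J : X →L[ℂ] DASpace m E, ∀ x j, (J x).coeff j = obsCoeff A c x j :=
    ⟨ofCoeffCLM (obsCoeff A c) (sum_norm_obsCoeff_sq_le h), coeff_ofCoeffCLM _ _⟩
  refine ⟨J, fun x => ext_coeff fun j => ?_⟩
  simp only [coeff_add, coeff_sum, coeff_shift, hJ]
  exact obsCoeff_eq x j

end DASpace

/-! ### Equations along contractive columns, and point evaluations -/

theorem norm_sum_smul_le {V : Type*} [NormedAddCommGroup V] [NormedSpace ℂ V]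
    (z : EuclideanSpace ℂ (Fin m)) (v : Fin m → V) {r : ℝ} (hr : 0 ≤ r)
    (hv : ∑ i, ‖v i‖ ^ 2 ≤ r ^ 2) : ‖∑ i, z i • v i‖ ≤ ‖z‖ * r := by
  calc ‖∑ i, z i • v i‖ ≤ ∑ i, ‖z i‖ * ‖v i‖ :=
        (norm_sum_le _ _).trans_eq (Finset.sum_congr rfl fun i _ => norm_smul _ _)
    _ ≤ ‖z‖ * r := by
        refine le_of_sq_le_sq ((Finset.sum_mul_sq_le_sq_mul_sq _ _ _).trans ?_) (by positivity)
        rw [mul_pow, EuclideanSpace.norm_sq_eq]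
        gcongr

/-- If `A` is a contractive column and `z` lies in the ball, then `δ = 0` is the only solution of
`δ = ∑ zᵢ δ Aᵢ`. -/
theorem eq_zero_of_eq_sum_smul {V : Type*} [NormedAddCommGroup V] [NormedSpace ℂ V]
    {A : Fin m → X →L[ℂ] X} (hA : ∀ x, ∑ i, ‖A i x‖ ^ 2 ≤ ‖x‖ ^ 2) (z : Ball m) (δ : X →L[ℂ] V)
    (hδ : ∀ x, δ x = ∑ i, z.1 i • δ (A i x)) : δ = 0 := by
  have hz : ‖z.1‖ < 1 := mem_ball_zero_iff.1 z.2
  have key : ‖δ‖ ≤ ‖δ‖ * ‖z.1‖ := by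
    refine δ.opNorm_le_bound (by positivity) fun x => ?_
    have h : δ x = δ (∑ i, z.1 i • A i x) := by
      simp only [map_sum, map_smul]
      exact hδ x
    rw [h, mul_assoc]
    exact (δ.le_opNorm _).trans (mul_le_mul_of_nonneg_left
      (norm_sum_smul_le _ _ (norm_nonneg x) (hA x)) (norm_nonneg δ))
  have h0 : ‖δ‖ = 0 := by nlinarith [norm_nonneg δ]
  exact norm_eq_zero.1 h0

namespace DASpace

theorem norm_sum_smul_backShift_lt_one (z : Ball m) :
    ‖∑ i, z.1 i • (backShift i : DASpace m E →L[ℂ] DASpace m E)‖ < 1 := by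
  refine lt_of_le_of_lt (ContinuousLinearMap.opNorm_le_bound _ (norm_nonneg z.1) fun f => ?_)
    (mem_ball_zero_iff.1 z.2)
  simp only [sum_apply, smul_apply]
  exact norm_sum_smul_le _ _ (norm_nonneg f) (sum_norm_backShift_sq_le f)

/-- A bounded operator `δ` on a coinvariant subspace `K` that is compatible with the backward
shifts and a contractive column `A` vanishes, since `‖δ k‖` is controlled by the tails of `k`. -/
theorem eq_zero_of_inner_eq_sum_backShift {K : Submodule ℂ (DASpace m E)}
    (hK : ∀ i, ∀ k ∈ K, backShift i k ∈ K) {A : Fin m → X → X}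
    (hA : ∀ x, ∑ i, ‖A i x‖ ^ 2 ≤ ‖x‖ ^ 2) (δ : DASpace m E →L[ℂ] X)
    (hδ : ∀ k ∈ K, ∀ x, inner ℂ x (δ k) = ∑ i, inner ℂ (A i x) (δ (backShift i k)))
    {k : DASpace m E} (hk : k ∈ K) : δ k = 0 := by
  have hstep : ∀ k ∈ K, ‖δ k‖ ^ 2 ≤ ∑ i, ‖δ (backShift i k)‖ ^ 2 := by
    intro k hk
    have h1 : ‖δ k‖ ^ 2 ≤ ∑ i, ‖A i (δ k)‖ * ‖δ (backShift i k)‖ := by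
      have : ‖δ k‖ ^ 2 = ‖(inner ℂ (δ k) (δ k) : ℂ)‖ := by
        rw [inner_self_eq_norm_sq_to_K]
        simp
      rw [this, hδ k hk]
      exact (norm_sum_le _ _).trans (Finset.sum_le_sum fun i _ => norm_inner_le_norm _ _)
    have h2 : ∑ i, ‖A i (δ k)‖ * ‖δ (backShift i k)‖
        ≤ ∑ i, (‖A i (δ k)‖ ^ 2 + ‖δ (backShift i k)‖ ^ 2) / 2 :=
      Finset.sum_le_sum fun i _ => by
        nlinarith [sq_nonneg (‖A i (δ k)‖ - ‖δ (backShift i k)‖)]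
    rw [← Finset.sum_div, Finset.sum_add_distrib] at h2
    linarith [hA (δ k)]
  have htail : ∀ n, ∀ k ∈ K, ‖δ k‖ ^ 2 ≤ ‖δ‖ ^ 2 * tail n k := by
    intro n
    induction n with
    | zero =>
      intro k _
      rw [tail_zero, ← mul_pow]
      exact pow_le_pow_left₀ (norm_nonneg _) (δ.le_opNorm k) 2
    | succ n ih =>
      intro k hk
      rw [← sum_tail_backShift, Finset.mul_sum]
      exact (hstep k hk).trans (Finset.sum_le_sum fun i _ => ih _ (hK i k hk))
  have hlim := (tendsto_tail k).const_mul (‖δ‖ ^ 2)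
  rw [mul_zero] at hlim
  have h0 := ge_of_tendsto' hlim fun n => htail n k hk
  simpa using h0

/-- Point evaluation at `z` is `f ↦ ((1 - ∑ zᵢ Bᵢ)⁻¹ f) 0`, where `Bᵢ` is the backward shift. In
this form it is defined for all `z ∈ ℂᵐ`, with a junk value where `1 - ∑ zᵢ Bᵢ` is not
invertible. -/
def evalResolvent (z : EuclideanSpace ℂ (Fin m)) : DASpace m E →L[ℂ] E :=
  coeffCLM 0 ∘L Ring.inverse (1 - ∑ i, z i • (backShift i : DASpace m E →L[ℂ] DASpace m E))

variable [CompleteSpace E]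

theorem isUnit_one_sub_sum_smul_backShift (z : Ball m) :
    IsUnit (1 - ∑ i, z.1 i • (backShift i : DASpace m E →L[ℂ] DASpace m E)) :=
  (Units.oneSub _ (norm_sum_smul_backShift_lt_one z)).isUnit

theorem evalResolvent_eq (z : Ball m) :
    (evalResolvent z.1 : DASpace m E →L[ℂ] E) = evalCLM z := by
  let T : DASpace m E →L[ℂ] DASpace m E := 1 - ∑ i, z.1 i • backShift i
  have h1 : (coeffCLM 0 : DASpace m E →L[ℂ] E) = evalCLM z ∘L T := by
    ext f
    simp only [T, ContinuousLinearMap.comp_apply, sub_apply, one_apply_eq_self, map_sub,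
      sum_apply, smul_apply, map_sum, map_smul, coeffCLM_apply]
    rw [evalCLM_eq_add_sum z f, add_sub_cancel_right]
  have h2 : T * Ring.inverse T = 1 :=
    Ring.mul_inverse_cancel _ (isUnit_one_sub_sum_smul_backShift z)
  calc (evalResolvent z.1 : DASpace m E →L[ℂ] E) = (evalCLM z ∘L T) ∘L Ring.inverse T := by
        rw [← h1]
        rfl
    _ = evalCLM z ∘L (T * Ring.inverse T) := rfl
    _ = evalCLM z := by
        rw [h2]
        rfl

theorem differentiableOn_evalResolvent :
    DifferentiableOn ℂ (evalResolvent : EuclideanSpace ℂ (Fin m) → DASpace m E →L[ℂ] E)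
      (Metric.ball 0 1) := by
  refine (differentiableOn_const _).clm_comp (DifferentiableOn.inverse ?_ fun z hz =>
    isUnit_one_sub_sum_smul_backShift ⟨z, hz⟩)
  fun_prop

end DASpace

/-! ### Contractions and defect operators on Hilbert spaces -/

/-- If `‖b k‖ ≤ ‖a k‖` for all `k`, then `a k ↦ b k` extends to a contraction, here given by its
adjoint `W`. -/
theorem exists_adjoint_contraction {K Y Z : Type*} [AddCommGroup K] [Module ℂ K]
    [NormedAddCommGroup Y] [InnerProductSpace ℂ Y] [CompleteSpace Y]
    [NormedAddCommGroup Z] [InnerProductSpace ℂ Z] [CompleteSpace Z]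
    (a : K →ₗ[ℂ] Y) (b : K →ₗ[ℂ] Z) (h : ∀ k, ‖b k‖ ≤ ‖a k‖) :
    ∃ W : Z →L[ℂ] Y, (∀ y, ‖W y‖ ≤ ‖y‖) ∧ ∀ y k, inner ℂ (W y) (a k) = inner ℂ y (b k) := by
  let S := (LinearMap.range a).topologicalClosure
  have : CompleteSpace S := (LinearMap.range a).isClosed_topologicalClosure.completeSpace_coe
  have hS : ∀ k, a k ∈ S := fun k => Submodule.le_topologicalClosure _ ⟨k, rfl⟩
  let e : K →ₗ[ℂ] S := a.codRestrict S hS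
  have hd : DenseRange e := by
    have h1 : Set.range e = Subtype.val ⁻¹' (Set.range a) := by
      ext y
      simp [e, Subtype.ext_iff]
    rw [DenseRange, h1, Subtype.dense_iff]
    intro y hy
    have h2 : (Subtype.val : S → Y) '' (Subtype.val ⁻¹' Set.range a) = Set.range a := by
      rw [Set.image_preimage_eq_inter_range, Subtype.range_coe, Set.inter_eq_left]
      rintro _ ⟨k, rfl⟩
      exact hS k
    exact h2.symm ▸ hy
  have hb : ∀ k, ‖b k‖ ≤ 1 * ‖e k‖ := fun k => by rw [one_mul]; exact h k
  let V : Y →L[ℂ] Z := (b.extendOfNorm e) ∘L S.orthogonalProjectionOnto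
  have hV : ‖V‖ ≤ 1 := V.opNorm_le_bound zero_le_one fun y => by
    refine (b.norm_extendOfNorm_apply_le hd 1 hb _).trans ?_
    rw [one_mul, one_mul]
    exact S.norm_orthogonalProjectionOnto_apply_le y
  refine ⟨V.adjoint, fun y => ?_, fun y k => ?_⟩
  · refine (V.adjoint.le_opNorm y).trans ?_
    rw [LinearIsometryEquiv.norm_map]
    exact mul_le_of_le_one_left (norm_nonneg y) hV
  · rw [ContinuousLinearMap.adjoint_inner_left]
    congr 1
    have h1 : S.orthogonalProjectionOnto (a k) = e k :=
      S.orthogonalProjectionOnto_mem_subspace_eq_self (e k)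
    exact (congrArg _ h1).trans (b.extendOfNorm_eq hd ⟨1, hb⟩ k)

/-- The defect operator of a contraction `R`: there is `Q` with `Q* Q = 1 - R R*`. -/
theorem exists_defect [CompleteSpace X] {H : Type*} [NormedAddCommGroup H] [InnerProductSpace ℂ H]
    [CompleteSpace H] (R : X →L[ℂ] H) (hR : ‖R‖ ≤ 1) :
    ∃ Q : H →L[ℂ] H, ∀ k, ‖Q k‖ ^ 2 + ‖R.adjoint k‖ ^ 2 = ‖k‖ ^ 2 := by
  let D : H →L[ℂ] H := 1 - R ∘L R.adjoint
  have hD : ∀ k, inner ℂ (D k) k = ((‖k‖ ^ 2 - ‖R.adjoint k‖ ^ 2 : ℝ) : ℂ) := by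
    intro k
    simp only [D, sub_apply, one_apply_eq_self, inner_sub_left,
      ContinuousLinearMap.comp_apply]
    rw [← ContinuousLinearMap.adjoint_inner_right, inner_self_eq_norm_sq_to_K,
      inner_self_eq_norm_sq_to_K]
    push_cast
    rfl
  have hpos : 0 ≤ D := by
    rw [ContinuousLinearMap.nonneg_iff_isPositive]
    rw [ContinuousLinearMap.isPositive_iff_complex]
    intro k
    rw [hD k]
    refine ⟨rfl, ?_⟩
    have h1 : ‖R.adjoint k‖ ≤ ‖k‖ := by
      refine (R.adjoint.le_opNorm k).trans ?_
      rw [LinearIsometryEquiv.norm_map]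
      exact mul_le_of_le_one_left (norm_nonneg k) hR
    have h2 := pow_le_pow_left₀ (norm_nonneg _) h1 2
    exact sub_nonneg.2 h2
  refine ⟨CFC.sqrt D, fun k => ?_⟩
  have hs : (CFC.sqrt D).adjoint = CFC.sqrt D :=
    (CFC.sqrt_nonneg D).isSelfAdjoint.star_eq
  have h1 : inner ℂ (D k) k = ((‖CFC.sqrt D k‖ ^ 2 : ℝ) : ℂ) := by
    conv_lhs => rw [← CFC.sqrt_mul_sqrt_self D hpos]
    rw [mul_apply_eq_comp]
    nth_rewrite 1 [← hs]
    rw [ContinuousLinearMap.adjoint_inner_left, inner_self_eq_norm_sq_to_K]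
    push_cast
    rfl
  rw [hD k] at h1
  have h2 := Complex.ofReal_injective h1
  linarith

end

section

open DASpace WithLp

variable {m : ℕ} {D E F : Type*}
  [NormedAddCommGroup D] [InnerProductSpace ℂ D]
  [NormedAddCommGroup E] [InnerProductSpace ℂ E]
  [NormedAddCommGroup F] [InnerProductSpace ℂ F]

/-! ### Transfer functions -/

/-- A contraction `W : 𝓓 ⊕ 𝓕 → 𝓓ᵐ ⊕ 𝓔` gives a contractive column on `𝓓 ⊕ (H²ₘ ⊗ 𝓕)`. -/
theorem norm_colligation_sq_le
    (W : WithLp 2 (D × F) →L[ℂ] WithLp 2 (PiLp 2 (fun _ : Fin m => D) × E))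
    (hW : ∀ y, ‖W y‖ ≤ ‖y‖) (x : WithLp 2 (D × DASpace m F)) :
    ‖(W (toLp 2 (x.fst, x.snd.coeff 0))).snd‖ ^ 2
      + ∑ i, ‖(toLp 2 ((W (toLp 2 (x.fst, x.snd.coeff 0))).fst i, backShift i x.snd) :
          WithLp 2 (D × DASpace m F))‖ ^ 2 ≤ ‖x‖ ^ 2 := by
  have h1 : ∑ i, ‖(W (toLp 2 (x.fst, x.snd.coeff 0))).fst i‖ ^ 2
      + ‖(W (toLp 2 (x.fst, x.snd.coeff 0))).snd‖ ^ 2 ≤ ‖x.fst‖ ^ 2 + ‖x.snd.coeff 0‖ ^ 2 := by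
    have h := pow_le_pow_left₀ (norm_nonneg _) (hW (toLp 2 (x.fst, x.snd.coeff 0))) 2
    rw [prod_norm_sq_eq_of_L2, prod_norm_sq_eq_of_L2, PiLp.norm_sq_eq_of_L2] at h
    exact h
  simp only [prod_norm_sq_eq_of_L2 _, toLp_fst, toLp_snd, Finset.sum_add_distrib]
  rw [norm_sq_eq_add_sum_backShift x.snd]
  linarith

variable [CompleteSpace E] [CompleteSpace F]

/-- The transfer function of a contraction `W : 𝓓 ⊕ 𝓕 → 𝓓ᵐ ⊕ 𝓔` is a multiplier `φ`. With
`A i (d, f) = (Wᵢ (d, f 0), Bᵢ f)` and `c (d, f) = W_𝓔 (d, f 0)`, where `Bᵢ` is the backward shift,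
the operator `J` is the observability operator of the column `(c, A)` on `𝓓 ⊕ (H²ₘ ⊗ 𝓕)`, and
multiplication by `φ` is its restriction to `H²ₘ ⊗ 𝓕`. -/
theorem exists_transfer_multiplier
    (W : WithLp 2 (D × F) →L[ℂ] WithLp 2 (PiLp 2 (fun _ : Fin m => D) × E))
    (hW : ∀ y, ‖W y‖ ≤ ‖y‖) :
    ∃ (J : WithLp 2 (D × DASpace m F) →L[ℂ] DASpace m E) (φ : Multiplier m F E),
      (∀ f, φ.mulOp f = J (toLp 2 (0, f))) ∧
      ∀ d f, J (toLp 2 (d, f)) = const (W (toLp 2 (d, f.coeff 0))).snd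
        + ∑ i, shift i (J (toLp 2 ((W (toLp 2 (d, f.coeff 0))).fst i, backShift i f))) := by
  let Y := WithLp 2 (D × DASpace m F)
  let u : Y →L[ℂ] WithLp 2 (PiLp 2 (fun _ : Fin m => D) × E) :=
    W ∘L (prodContinuousLinearEquiv 2 ℂ D F).symm.toContinuousLinearMap ∘L
      ((fstL 2 ℂ D (DASpace m F)).prod (coeffCLM 0 ∘L sndL 2 ℂ D (DASpace m F)))
  let A : Fin m → Y →L[ℂ] Y := fun i =>
    (prodContinuousLinearEquiv 2 ℂ D (DASpace m F)).symm.toContinuousLinearMap ∘L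
      ((PiLp.proj 2 (fun _ : Fin m => D) i ∘L fstL 2 ℂ _ E ∘L u).prod
        (backShift i ∘L sndL 2 ℂ D (DASpace m F)))
  let c : Y →L[ℂ] E := sndL 2 ℂ _ E ∘L u
  have hu : ∀ x : Y, u x = W (toLp 2 (x.fst, x.snd.coeff 0)) := fun _ => rfl
  have hA : ∀ i (x : Y), A i x = toLp 2 ((u x).fst i, backShift i x.snd) := fun _ _ => rfl
  have hcol : ∀ x : Y, ‖c x‖ ^ 2 + ∑ i, ‖A i x‖ ^ 2 ≤ ‖x‖ ^ 2 := norm_colligation_sq_le W hW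
  obtain ⟨J, hJ⟩ := exists_observability hcol
  have hJ' : ∀ d f, J (toLp 2 (d, f)) = const (W (toLp 2 (d, f.coeff 0))).snd
        + ∑ i, shift i (J (toLp 2 ((W (toLp 2 (d, f.coeff 0))).fst i, backShift i f))) :=
    fun d f => hJ (toLp 2 (d, f))
  let inl : D →L[ℂ] Y := (prodContinuousLinearEquiv 2 ℂ D (DASpace m F)).symm.toContinuousLinearMap
    ∘L ContinuousLinearMap.inl ℂ D (DASpace m F)
  let inr : DASpace m F →L[ℂ] Y :=
    (prodContinuousLinearEquiv 2 ℂ D (DASpace m F)).symm.toContinuousLinearMap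
    ∘L ContinuousLinearMap.inr ℂ D (DASpace m F)
  -- The transfer function sends `v` to the value at `z` of the image of the constant function `v`.
  let φ : EuclideanSpace ℂ (Fin m) → F →L[ℂ] E := fun z => evalResolvent z ∘L J ∘L inr ∘L const
  have hφ : ∀ (z : Ball m) v, φ z.1 v = evalCLM z (J (inr (const v))) := fun z v => by
    simp only [φ, evalResolvent_eq]
    rfl
  have hmul : ∀ (z : Ball m) f, J (inr f) z = φ z.1 (f z) := by
    intro z f
    let χ : Y →L[ℂ] E := evalCLM z ∘L J ∘L inl ∘L fstL 2 ℂ D (DASpace m F)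
      + φ z.1 ∘L evalCLM z ∘L sndL 2 ℂ D (DASpace m F)
    have hχ : ∀ x : Y, χ x = evalCLM z (J (inl x.fst)) + φ z.1 (evalCLM z x.snd) := fun _ => rfl
    have hψ : ∀ x : Y, evalCLM z (J x) = c x + ∑ i, z.1 i • evalCLM z (J (A i x)) := fun x => by
      conv_lhs => rw [hJ x]
      simp only [map_add, map_sum]
      simp only [evalCLM_apply, const_apply, shift_apply]
    -- Both sides of `J (0, f) z = φ z (f z)` extend to solutions of the equation of `J` at `z`,
    -- which is uniquely solvable. The extension `χ` of the right-hand side solves it because `W`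
    -- is linear; this enters through the additivity of `G`.
    let G : WithLp 2 (PiLp 2 (fun _ : Fin m => D) × E) → E := fun w =>
      w.snd + ∑ i, z.1 i • evalCLM z (J (inl (w.fst i)))
    have hG : ∀ w w', G (w + w') = G w + G w' := fun w w' => by
      simp only [G, add_fst, add_snd, PiLp.add_apply, map_add, smul_add, Finset.sum_add_distrib]
      abel
    have hGl : ∀ d, evalCLM z (J (inl d)) = G (u (inl d)) := fun d => by
      have h : ∀ i, A i (inl d) = inl ((u (inl d)).fst i) := fun i => by
        rw [hA]
        change toLp 2 (_, backShift i 0) = _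
        rw [map_zero]
        rfl
      rw [hψ]
      simp only [h]
      rfl
    have hGr : ∀ v, φ z.1 v = G (u (inr (const v))) := fun v => by
      have h : ∀ i, A i (inr (const v)) = inl ((u (inr (const v))).fst i) := fun i => by
        rw [hA]
        change toLp 2 (_, backShift i (const v)) = _
        rw [backShift_const]
        rfl
      rw [hφ, hψ]
      simp only [h]
      rfl
    have hGu : ∀ x : Y, G (u x) = evalCLM z (J (inl x.fst)) + φ z.1 (x.snd.coeff 0) := fun x => by
      rw [hGl, hGr, ← hG, hu, hu, hu, ← map_add]
      congr 2
      change toLp 2 (x.fst, x.snd.coeff 0)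
        = toLp 2 (x.fst, (0 : F)) + toLp 2 (0, (const (x.snd.coeff 0) : DASpace m F).coeff 0)
      rw [← toLp_add, Prod.mk_add_mk, add_zero, zero_add, coeff_const, if_pos rfl]
    have h0 : evalCLM z ∘L J - χ = 0 := by
      refine eq_zero_of_eq_sum_smul (A := A) (fun x =>
        (le_add_of_nonneg_left (sq_nonneg _)).trans (hcol x)) z _ fun x => ?_
      have h1 : ∀ i, χ (A i x) = evalCLM z (J (inl ((u x).fst i)))
          + φ z.1 (evalCLM z (backShift i x.snd)) := fun i => rfl
      have h2 : c x = G (u x) - ∑ i, z.1 i • evalCLM z (J (inl ((u x).fst i))) :=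
        (add_sub_cancel_right _ _).symm
      simp only [sub_apply, ContinuousLinearMap.comp_apply, smul_sub, Finset.sum_sub_distrib, h1,
        smul_add, Finset.sum_add_distrib]
      rw [hψ, hχ, evalCLM_eq_add_sum z x.snd, h2, hGu]
      simp only [map_add, map_sum, map_smul]
      abel
    have h3 := DFunLike.congr_fun h0 (inr f)
    rw [sub_apply, zero_apply, sub_eq_zero, hχ] at h3
    change evalCLM z (J (inr f)) = evalCLM z (J (inl 0)) + φ z.1 (evalCLM z f) at h3
    rwa [map_zero, map_zero, map_zero, zero_add] at h3
  let Φ : Multiplier m F E :=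
    { toFun := φ
      holomorphic := differentiableOn_evalResolvent.clm_comp (differentiableOn_const _)
      exists_mul := fun f => ⟨J (inr f), fun z => hmul z f⟩ }
  refine ⟨J, Φ, fun f => RKHS.ext fun z => ?_, hJ'⟩
  rw [Multiplier.mulOp_apply]
  exact (hmul z f).symm

/-! ### Commutant lifting -/

/-- The isometry `(Q Bᵢ k)ᵢ ⊕ k 0 ↦ Q k ⊕ (R* k) 0`, or rather the adjoint of a contractive
extension of it, where `Q` is the defect operator of `R`. -/
theorem exists_lurking_contraction [CompleteSpace D] {K : Submodule ℂ (DASpace m E)}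
    {R : DASpace m F →L[ℂ] DASpace m E}
    (hR : ∀ i, ∀ k ∈ K, R.adjoint (backShift i k) = backShift i (R.adjoint k))
    {Q : DASpace m E →L[ℂ] D} (hQ : ∀ k, ‖Q k‖ ^ 2 + ‖R.adjoint k‖ ^ 2 = ‖k‖ ^ 2) :
    ∃ W : WithLp 2 (D × F) →L[ℂ] WithLp 2 (PiLp 2 (fun _ : Fin m => D) × E),
      (∀ y, ‖W y‖ ≤ ‖y‖) ∧ ∀ d v, ∀ k ∈ K,
        inner ℂ (W (toLp 2 (d, v))).snd (k.coeff 0)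
          + ∑ i, inner ℂ ((W (toLp 2 (d, v))).fst i) (Q (backShift i k))
        = inner ℂ d (Q k) + inner ℂ v ((R.adjoint k).coeff 0) := by
  let a : K →ₗ[ℂ] WithLp 2 (PiLp 2 (fun _ : Fin m => D) × E) :=
    { toFun := fun k => toLp 2 (toLp 2 fun i => Q (backShift i k.1), k.1.coeff 0)
      map_add' := fun k l => by
        simp only [Submodule.coe_add, map_add, coeff_add]
        rfl
      map_smul' := fun t k => by
        simp only [Submodule.coe_smul, map_smul, coeff_smul]
        rfl }
  let b : K →ₗ[ℂ] WithLp 2 (D × F) :=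
    { toFun := fun k => toLp 2 (Q k.1, (R.adjoint k.1).coeff 0)
      map_add' := fun k l => by
        simp only [Submodule.coe_add, map_add, coeff_add]
        rfl
      map_smul' := fun t k => by
        simp only [Submodule.coe_smul, map_smul, coeff_smul]
        rfl }
  have ha : ∀ k : K, a k = toLp 2 (toLp 2 fun i => Q (backShift i k.1), k.1.coeff 0) := fun _ => rfl
  have hb : ∀ k : K, b k = toLp 2 (Q k.1, (R.adjoint k.1).coeff 0) := fun _ => rfl
  have hab : ∀ k : K, ‖b k‖ ≤ ‖a k‖ := by
    intro k
    refine le_of_sq_le_sq (le_of_eq ?_) (norm_nonneg _)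
    rw [ha, hb, prod_norm_sq_eq_of_L2, prod_norm_sq_eq_of_L2, PiLp.norm_sq_eq_of_L2]
    have h1 : ∑ i, (‖Q (backShift i k.1)‖ ^ 2 + ‖backShift i (R.adjoint k.1)‖ ^ 2)
        = ∑ i, ‖backShift i k.1‖ ^ 2 :=
      Finset.sum_congr rfl fun i _ => by rw [← hR i k.1 k.2, hQ]
    rw [Finset.sum_add_distrib] at h1
    have h2 := norm_sq_eq_add_sum_backShift k.1
    have h3 := norm_sq_eq_add_sum_backShift (R.adjoint k.1)
    have h4 := hQ k.1
    change ‖Q k.1‖ ^ 2 + ‖(R.adjoint k.1).coeff 0‖ ^ 2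
      = ∑ i, ‖Q (backShift i k.1)‖ ^ 2 + ‖k.1.coeff 0‖ ^ 2
    linarith
  obtain ⟨W, hW, hWab⟩ := exists_adjoint_contraction a b hab
  refine ⟨W, hW, fun d v k hk => ?_⟩
  have h := hWab (toLp 2 (d, v)) ⟨k, hk⟩
  rw [ha, hb, prod_inner_apply, prod_inner_apply, PiLp.inner_apply, add_comm] at h
  exact h

/-- Commutant lifting for contractions: a contraction into `H²ₘ ⊗ 𝓔` that intertwines the
coordinate shifts modulo a closed invariant subspace `N` agrees modulo `N` with a multiplier. -/
theorem exists_multiplier_sub_mem_of_norm_le_one {N : Submodule ℂ (DASpace m E)}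
    (hN : IsClosed (N : Set (DASpace m E))) (hinv : ∀ i, ∀ g ∈ N, shift i g ∈ N)
    (R : DASpace m F →L[ℂ] DASpace m E) (hR1 : ‖R‖ ≤ 1)
    (hR : ∀ i f, R (shift i f) - shift i (R f) ∈ N) :
    ∃ φ : Multiplier m F E, ∀ f, R f - φ.mulOp f ∈ N := by
  have hK : ∀ i, ∀ k ∈ Nᗮ, backShift i k ∈ Nᗮ := fun i k hk => by
    rw [Submodule.mem_orthogonal] at hk ⊢
    intro g hg
    rw [← inner_shift_left]
    exact hk _ (hinv i g hg)
  have hRK : ∀ i, ∀ k ∈ Nᗮ, R.adjoint (backShift i k) = backShift i (R.adjoint k) := by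
    intro i k hk
    refine ext_inner_left ℂ fun f => ?_
    rw [ContinuousLinearMap.adjoint_inner_right, ← inner_shift_left, ← inner_shift_left,
      ContinuousLinearMap.adjoint_inner_right]
    have := (Submodule.mem_orthogonal _ _).1 hk _ (hR i f)
    rw [inner_sub_left, sub_eq_zero] at this
    exact this.symm
  obtain ⟨Q, hQ⟩ := exists_defect R hR1
  obtain ⟨W, hW, hWK⟩ := exists_lurking_contraction hRK hQ
  obtain ⟨J, φ, hφ, hJ⟩ := exists_transfer_multiplier W hW
  refine ⟨φ, fun f => ?_⟩
  let L : DASpace m E →L[ℂ] WithLp 2 (DASpace m E × DASpace m F) :=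
    (prodContinuousLinearEquiv 2 ℂ _ _).symm.toContinuousLinearMap ∘L Q.prod R.adjoint
  have hL : ∀ k, L k = toLp 2 (Q k, R.adjoint k) := fun _ => rfl
  let A : Fin m → WithLp 2 (DASpace m E × DASpace m F) → WithLp 2 (DASpace m E × DASpace m F) :=
    fun i x => toLp 2 ((W (toLp 2 (x.fst, x.snd.coeff 0))).fst i, backShift i x.snd)
  have hA : ∀ x, ∑ i, ‖A i x‖ ^ 2 ≤ ‖x‖ ^ 2 := by
    intro x
    exact (le_add_of_nonneg_left (sq_nonneg _)).trans (norm_colligation_sq_le W hW x)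
  -- On the coinvariant subspace the adjoint of `J` is the column `k ↦ (Q k, R* k)`.
  have hδ : ∀ k ∈ Nᗮ, (J.adjoint - L) k = 0 := by
    intro k hk
    refine eq_zero_of_inner_eq_sum_backShift hK hA _ (fun k hk x => ?_) hk
    simp only [sub_apply, inner_sub_right, ContinuousLinearMap.adjoint_inner_right,
      Finset.sum_sub_distrib]
    have h1 : inner ℂ (J x) k = inner ℂ (W (toLp 2 (x.fst, x.snd.coeff 0))).snd (k.coeff 0)
        + ∑ i, inner ℂ (J (A i x)) (backShift i k) := by
      have := congrArg (fun g => inner ℂ g k) (hJ x.fst x.snd)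
      simp only [inner_add_left, sum_inner, inner_const_left, inner_shift_left] at this
      exact this
    have h2 : ∑ i, inner ℂ (A i x) (L (backShift i k))
        = ∑ i, inner ℂ ((W (toLp 2 (x.fst, x.snd.coeff 0))).fst i) (Q (backShift i k))
          + ∑ i, inner ℂ (backShift i x.snd) (backShift i (R.adjoint k)) := by
      rw [← Finset.sum_add_distrib]
      refine Finset.sum_congr rfl fun i _ => ?_
      rw [hL, hRK i k hk, prod_inner_apply]
    have h3 : inner ℂ x (L k) = inner ℂ x.fst (Q k) + inner ℂ x.snd (R.adjoint k) := by
      rw [hL, prod_inner_apply]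
      rfl
    rw [h1, h2, h3, inner_eq_add_sum_backShift x.snd]
    linear_combination hWK x.fst (x.snd.coeff 0) k hk
  have : CompleteSpace N := hN.completeSpace_coe
  rw [← N.orthogonal_orthogonal, Submodule.mem_orthogonal']
  intro k hk
  have h := hδ k hk
  rw [sub_apply, sub_eq_zero] at h
  rw [hφ, inner_sub_left, ← ContinuousLinearMap.adjoint_inner_right,
    ← ContinuousLinearMap.adjoint_inner_right, h, hL, prod_inner_apply]
  simp

theorem Multiplier.exists_mulOp_eq_smul (t : ℂ) (φ : Multiplier m F E) :
    ∃ ψ : Multiplier m F E, ∀ f, ψ.mulOp f = t • φ.mulOp f := by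
  let ψ : Multiplier m F E :=
    { toFun := fun z => t • φ.toFun z
      holomorphic := φ.holomorphic.const_smul t
      exists_mul := fun f => ⟨t • φ.mulOp f, fun z => by simp [Multiplier.mulOp_apply]⟩ }
  exact ⟨ψ, fun f => RKHS.ext fun z => by simp [Multiplier.mulOp_apply, ψ]⟩

/-- Commutant lifting: a bounded operator into `H²ₘ ⊗ 𝓔` that intertwines the coordinate shifts
modulo a closed invariant subspace `N` agrees modulo `N` with a multiplier. -/
theorem exists_multiplier_sub_mem {N : Submodule ℂ (DASpace m E)}
    (hN : IsClosed (N : Set (DASpace m E))) (hinv : ∀ i, ∀ g ∈ N, shift i g ∈ N)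
    (R : DASpace m F →L[ℂ] DASpace m E) (hR : ∀ i f, R (shift i f) - shift i (R f) ∈ N) :
    ∃ φ : Multiplier m F E, ∀ f, R f - φ.mulOp f ∈ N := by
  -- Any positive upper bound for `‖R‖` can be scaled away; `‖R‖` itself may vanish.
  let t : ℂ := ((‖R‖ + 1 : ℝ) : ℂ)
  have ht : t ≠ 0 := by
    have : ‖R‖ + 1 ≠ 0 := by positivity
    exact Complex.ofReal_ne_zero.2 this
  have htn : ‖t‖ = ‖R‖ + 1 := by
    rw [Complex.norm_real, Real.norm_of_nonneg (by positivity)]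
  obtain ⟨φ, hφ⟩ := exists_multiplier_sub_mem_of_norm_le_one hN hinv (t⁻¹ • R)
    (by
      rw [norm_smul, norm_inv, htn, inv_mul_le_one₀ (by positivity)]
      linarith)
    (fun i f => by
      have := N.smul_mem t⁻¹ (hR i f)
      simpa [smul_sub] using this)
  obtain ⟨ψ, hψ⟩ := φ.exists_mulOp_eq_smul t
  refine ⟨ψ, fun f => ?_⟩
  have := N.smul_mem t (hφ f)
  rwa [smul_apply, smul_sub, smul_smul, mul_inv_cancel₀ ht, one_smul, ← hψ] at this

end

section

open DASpace

variable {m : ℕ} {E Es F : Type*}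
  [NormedAddCommGroup E] [InnerProductSpace ℂ E] [CompleteSpace E]
  [NormedAddCommGroup Es] [InnerProductSpace ℂ Es] [CompleteSpace Es]
  [NormedAddCommGroup F] [InnerProductSpace ℂ F] [CompleteSpace F]

/-! ### Lifting module maps into the quotient module -/

/-- `ran M_θ` as a complex subspace. -/
def Multiplier.ranComplex (θ : Multiplier m E Es) : Submodule ℂ (DASpace m Es) where
  carrier := θ.ran
  add_mem' := θ.ran.add_mem
  zero_mem' := θ.ran.zero_mem
  smul_mem' a f hf := by
    have := θ.ran.smul_mem (MvPolynomial.C a) hf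
    rwa [C_smul] at this

theorem Multiplier.mem_ranComplex {θ : Multiplier m E Es} {f : DASpace m Es} :
    f ∈ θ.ranComplex ↔ f ∈ θ.ran :=
  Iff.rfl

/-- `H²ₘ ⊗ 𝓕` is projective relative to quotients by closed submodules `ran M_θ`: a module map into
the quotient lifts to a multiplier. -/
theorem exists_multiplier_lift (θ : Multiplier m E Es)
    (hclosed : IsClosed (θ.ran : Set (DASpace m Es)))
    (T : DASpace m F →L[MvPolynomial (Fin m) ℂ] θ.QuotientModule) :
    ∃ φ : Multiplier m F Es, θ.quotientMap.comp φ.mulOp = T := by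
  have hcl : IsClosed (θ.ranComplex : Set (DASpace m Es)) := hclosed
  have : CompleteSpace θ.ranComplex := hcl.completeSpace_coe
  -- The projection onto the orthogonal complement of `ran M_θ` descends to a continuous section of
  -- the quotient map, which is linear over `ℂ` but in general not a module map.
  let P : DASpace m Es →L[ℂ] DASpace m Es := θ.ranComplex.orthogonal.starProjection
  have hP : ∀ g, g - P g ∈ θ.ran := fun g => by
    have := θ.ranComplexᗮ.sub_starProjection_mem_orthogonal g
    rwa [θ.ranComplex.orthogonal_orthogonal] at this
  have hP0 : ∀ g ∈ θ.ran, P g = 0 := fun g hg => by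
    refine Submodule.starProjection_apply_eq_zero_iff _ |>.2 ?_
    rw [θ.ranComplex.orthogonal_orthogonal]
    exact hg
  let p : θ.QuotientModule → DASpace m Es := Quotient.lift P fun f g hfg => by
    have h := hP0 _ ((Submodule.quotientRel_def _).1 hfg)
    rwa [map_sub, sub_eq_zero] at h
  have hpc : Continuous p := θ.ran.isQuotientMap_mkQL.continuous_iff.2 P.continuous
  have hqp : ∀ x, θ.quotientMap (p x) = x := fun x => by
    obtain ⟨g, rfl⟩ := θ.ran.mkQ_surjective x
    refine (Submodule.Quotient.eq _).2 ?_
    rw [← neg_sub]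
    exact θ.ran.neg_mem (hP g)
  have hsmul : ∀ (a : ℂ) x, p ((MvPolynomial.C a : MvPolynomial (Fin m) ℂ) • x) = a • p x := by
    intro a x
    obtain ⟨g, rfl⟩ := θ.ran.mkQ_surjective x
    change P ((MvPolynomial.C a : MvPolynomial (Fin m) ℂ) • g) = a • P g
    rw [C_smul, map_smul]
  have hadd : ∀ x y, p (x + y) = p x + p y := by
    intro x y
    obtain ⟨f, rfl⟩ := θ.ran.mkQ_surjective x
    obtain ⟨g, rfl⟩ := θ.ran.mkQ_surjective y
    exact P.map_add f g
  let R : DASpace m F →L[ℂ] DASpace m Es :=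
    { toFun := fun f => p (T f)
      map_add' := fun f g => by rw [map_add, hadd]
      map_smul' := fun a f => by rw [← C_smul, map_smul, hsmul, RingHom.id_apply]
      cont := hpc.comp T.continuous }
  have hR : ∀ f, θ.quotientMap (R f) = T f := fun f => hqp _
  have hmem : ∀ g, θ.quotientMap g = 0 ↔ g ∈ θ.ran := fun g => Submodule.Quotient.mk_eq_zero _
  obtain ⟨φ, hφ⟩ := exists_multiplier_sub_mem hcl
    (fun i g hg => by
      have := θ.ran.smul_mem (MvPolynomial.X i) hg
      rwa [X_smul] at this)
    R (fun i f => by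
      rw [Multiplier.mem_ranComplex, ← hmem, map_sub, hR, ← X_smul, ← X_smul, map_smul, map_smul,
        hR, sub_self])
  refine ⟨φ, ContinuousLinearMap.ext fun f => ?_⟩
  have h := (hmem _).2 (hφ f)
  rw [map_sub, hR, sub_eq_zero] at h
  exact h.symm

end

end DruryArveson

end

theorem mainTheorem9 (m : ℕ)
    {E Es F : Type*}
    [NormedAddCommGroup E] [InnerProductSpace ℂ E] [CompleteSpace E]
    [NormedAddCommGroup Es] [InnerProductSpace ℂ Es] [CompleteSpace Es]
    [NormedAddCommGroup F] [InnerProductSpace ℂ F] [CompleteSpace F]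
    (θ : DruryArveson.Multiplier m E Es)
    (hclosed : IsClosed (θ.ran : Set (DruryArveson.DASpace m Es)))
    (hsim : DruryArveson.Similar m θ.QuotientModule (DruryArveson.DASpace m F)) :
    (∃ φ : DruryArveson.Multiplier m F Es, DruryArveson.IsSkewDirectSum φ.ran θ.ran) ∧
      DruryArveson.IsComplemented θ.ran ∧
      θ.SequenceSplits := by
  obtain ⟨X⟩ := hsim
  obtain ⟨φ, hφ⟩ := DruryArveson.exists_multiplier_lift θ hclosed X.symm.toContinuousLinearMap
  have hφ' : ∀ f, θ.quotientMap (φ.mulOp f) = X.symm f := fun f => DFunLike.congr_fun hφ f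
  have hmem : ∀ g, θ.quotientMap g = 0 ↔ g ∈ θ.ran := fun g => Submodule.Quotient.mk_eq_zero _
  have hran : ∀ g, g ∈ φ.ran ↔ φ.mulOp (X (θ.quotientMap g)) = g := by
    refine fun g => ⟨?_, fun h => ⟨_, h⟩⟩
    rintro ⟨f, rfl⟩
    change φ.mulOp (X (θ.quotientMap (φ.mulOp f))) = φ.mulOp f
    rw [hφ', X.apply_symm_apply]
  have hsum : DruryArveson.IsSkewDirectSum φ.ran θ.ran := by
    refine ⟨?_, hclosed, ?_, ?_⟩
    · have : (φ.ran : Set (DruryArveson.DASpace m Es))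
          = {g | φ.mulOp (X (θ.quotientMap g)) = g} := Set.ext hran
      rw [this]
      exact isClosed_eq (φ.mulOp.continuous.comp (X.continuous.comp θ.quotientMap.continuous))
        continuous_id
    · rw [Submodule.disjoint_def]
      intro g hg hg'
      rw [← (hran g).1 hg, (hmem g).2 hg', map_zero, map_zero]
    · rw [codisjoint_iff, Submodule.eq_top_iff']
      intro g
      rw [Submodule.mem_sup]
      refine ⟨φ.mulOp (X (θ.quotientMap g)), ⟨_, rfl⟩, g - φ.mulOp (X (θ.quotientMap g)), ?_,
        add_sub_cancel _ _⟩
      rw [← hmem, map_sub, hφ', X.symm_apply_apply, sub_self]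
  refine ⟨⟨φ, hsum⟩, ⟨φ.ran, hsum.2.1, hsum.1, hsum.2.2.symm⟩,
    φ.mulOp.comp X.toContinuousLinearMap, ContinuousLinearMap.ext fun x => ?_⟩
  change θ.quotientMap (φ.mulOp (X x)) = x
  rw [hφ', X.symm_apply_apply]
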